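/- Let $E$ be a separable infinite-dimensional complex Fréchet space, whose topology is induced by an increasing sequence $(p_n)_{n\in\mathbb N}$ of seminorms. Let $C\in L(E)$ be injective with dense range $R(C)$, and let the closed linear operator $A$ on $E$ be a subgenerator of a global $C$-regularized semigroup $(S_0(t))_{t\ge 0}\subseteq L(E)$. This means that $t\mapsto S_0(t)x$ is continuous on $[0,\infty)$ for each $x\in E$ and that, for all $t\ge 0$, $S_0(t)A\subseteq AS_0(t)$, $S_0(t)C=CS_0(t)$ and, for every $x\in E$, $\int_0^tS_0(s)x\,ds\in D(A)$ and $A\int_0^tS_0(s)x\,ds=S_0(t)x-Cx$. Let $Z_1(A)$ be the set of all $x\in E$ for which there is exactly one continuous $u:[0,\infty)\to E$ with $\int_0^tu(s)\,ds\in D(A)$ and $A\int_0^tu(s)\,ds=u(t)-x$ for all $t\ge 0$. Put $T(t)x:=C^{-1}S_0(t)x$ for $t\ge 0$, $x\in Z_1(A)$. For a linear subspace $F$ of $E$ and an operator $B$ on $E$, the part $B_{|F}$ is the operator on $F$ with graph $\{(x,y)\in B: x,y\in F\}$. An operator $T$ on a space $X$ (with domain $D(T)\subseteq X$) is called frequently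 hypercyclic if there is $x\in\bigcap_{n}D(T^n)$ with $\liminf_{n\to\infty}\frac1n\,|\{k\in\{1,\dots,n\}:T^kx\in V\}|>0$ for every non-empty open $V\subseteq X$. A family $(T(t))_{t\ge 0}$ of operators on $X$ is called frequently hypercyclic if there is $x\in\bigcap_{t\ge0}D(T(t))$ with $\liminf_{t\to\infty}\frac1t\,m(\{s\in[0,t]:T(s)x\in V\})>0$ for every non-empty open $V\subseteq X$, where $m$ is Lebesgue measure. The $C$-regularized semigroup $(S_0(t))_{t\ge0}$ is called frequently hypercyclic if the family $(T(t))_{t\ge0}$ is. Let $\Omega\subseteq\mathbb C$ be open and connected, with $\Omega\subseteq\sigma_p(A)$ and $\Omega\cap i\mathbb R\ne\emptyset$, and let $f:\Omega\to E$ be an analytic mapping with $f(\lambda)\in N(A-\lambda)\setminus\{0\}$ for all $\lambda\in\Omega$. (i) Suppose that every $x^*\in E^*$ with $x^*(f(\lambda))=0$ for all $\lambda\in\Omega$ is $0$. Then $(S_0(t))_{t\ge0}$ is frequently hypercyclic, and for every $t_0>0$ the single operator $T(t_0)$ is frequently hypercyclic. (ii) Without the additional assumption of (i), let $\tilde E:=\overline{\operatorname{span}\{f(\lambda):\lambda\in\Omega\}}$.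 Then the family $(T(t)_{|\tilde E})_{t\ge0}$ is frequently hypercyclic in $\tilde E$, and for every $t_0>0$ the operator $T(t_0)_{|\tilde E}$ is frequently hypercyclic in $\tilde E$. If moreover $C(\tilde E)\subseteq\tilde E$ (so that $C_{|\tilde E}\in L(\tilde E)$), then $S_0(t)(\tilde E)\subseteq\tilde E$ for all $t\ge0$, the operator $A_{|\tilde E}$ is a subgenerator of the global $C_{|\tilde E}$-regularized semigroup $(S_0(t)_{|\tilde E})_{t\ge0}$ on $\tilde E$, this semigroup is frequently hypercyclic in $\tilde E$, and for every $t_0>0$ the operator $(C_{|\tilde E})^{-1}S_0(t_0)_{|\tilde E}$ with domain $Z_1(A_{|\tilde E})$ is frequently hypercyclic in $\tilde E$. -/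

import Mathlib

open Set Filter Topology MeasureTheory

open scoped ENNReal

section Operators

variable {E : Type*} [AddCommGroup E] [Module ℂ E] [TopologicalSpace E]

/-- The integral of an `E`-valued function over `[a, b]`, tested against the continuous linear
functionals: `y = ∫ s in a..b, u s`. In a Hausdorff locally convex space there is at most one such
`y`; if the space is moreover complete and `u` is continuous on `[a, b]`, it exists and is the
Riemann integral of `u`. -/
def HasVectorIntegral (u : ℝ → E) (a b : ℝ) (y : E) : Prop :=
  ∀ φ : E →L[ℂ] ℂ,
    IntervalIntegrable (fun s => φ (u s)) volume a b ∧ φ y = ∫ s in a..b, φ (u s)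

/-- The point spectrum of a (possibly unbounded) linear operator. -/
def LinearPMap.pointSpectrum (A : E →ₗ.[ℂ] E) : Set ℂ :=
  {z | ∃ x : E, x ≠ 0 ∧ (x, z • x) ∈ A.graph}

/-- The part of a (possibly unbounded) operator `A` in a linear subspace `F`: the operator on `F`
whose graph is `{(x, y) ∈ A : x, y ∈ F}`; see `LinearPMap.mem_graph_part`. -/
noncomputable def LinearPMap.part (A : E →ₗ.[ℂ] E) (F : Submodule ℂ E) : F →ₗ.[ℂ] F :=
  (A.graph.comap (F.subtype.prodMap F.subtype)).toLinearPMap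

theorem LinearPMap.mem_graph_part (A : E →ₗ.[ℂ] E) (F : Submodule ℂ E) (x y : F) :
    (x, y) ∈ (A.part F).graph ↔ ((x : E), (y : E)) ∈ A.graph := by
  unfold LinearPMap.part
  rw [Submodule.toLinearPMap_graph_eq]
  · simp
  · rintro ⟨a, b⟩ h (h0 : a = 0)
    subst h0
    have h1 : (((0 : F) : E), (b : E)) ∈ A.graph := by simpa using h
    have h2 : (b : E) = 0 := A.graph_fst_eq_zero_snd h1 (by simp)
    exact_mod_cast h2

/-- `A` is a subgenerator of the global `C`-regularized semigroup `(S t)_{t ≥ 0}`. Only the values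
`S t` with `t ≥ 0` matter. -/
structure IsSubgenerator (A : E →ₗ.[ℂ] E) (C : E →L[ℂ] E) (S : ℝ → E →L[ℂ] E) : Prop where
  isClosed : A.IsClosed
  injective : Function.Injective C
  continuousOn : ∀ x : E, ContinuousOn (fun t => S t x) (Ici 0)
  commute_op : ∀ t : ℝ, 0 ≤ t → ∀ x y : E, (x, y) ∈ A.graph → (S t x, S t y) ∈ A.graph
  commute_reg : ∀ t : ℝ, 0 ≤ t → ∀ x : E, S t (C x) = C (S t x)
  integral : ∀ t : ℝ, 0 ≤ t → ∀ x : E,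
    ∃ y : E, HasVectorIntegral (fun s => S s x) 0 t y ∧ (y, S t x - C x) ∈ A.graph

/-- `u` is a mild solution on `[0, ∞)` of `u' = A u`, `u 0 = x`. -/
def IsMildSolution (A : E →ₗ.[ℂ] E) (x : E) (u : ℝ → E) : Prop :=
  ContinuousOn u (Ici 0) ∧
    ∀ t : ℝ, 0 ≤ t → ∃ y : E, HasVectorIntegral u 0 t y ∧ (y, u t - x) ∈ A.graph

/-- The set `Z₁(A)` of those initial values for which there is one and only one mild solution
on `[0, ∞)`. -/
def mildSolutionSpace (A : E →ₗ.[ℂ] E) : Set E :=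
  {x | ∃ u : ℝ → E, IsMildSolution A x u ∧
    ∀ v : ℝ → E, IsMildSolution A x v → ∀ t : ℝ, 0 ≤ t → v t = u t}

/-- The graph of the operator `T(t) : x ↦ C⁻¹ (S t x)` with domain `Z₁(A)`. -/
def solutionOp (A : E →ₗ.[ℂ] E) (C : E →L[ℂ] E) (S : ℝ → E →L[ℂ] E) (t : ℝ) : Set (E × E) :=
  {p | p.1 ∈ mildSolutionSpace A ∧ C p.2 = S t p.1}

/-- The part in a linear subspace `F` of an operator given by its graph. -/
def graphPart (T : Set (E × E)) (F : Submodule ℂ E) : Set (F × F) :=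
  {p | ((p.1 : E), (p.2 : E)) ∈ T}

end Operators

/-- The lower density of a set of positive integers. -/
noncomputable def natLowerDensity (B : Set ℕ) : ℝ≥0∞ :=
  liminf (fun n : ℕ => ((B ∩ Icc 1 n).ncard : ℝ≥0∞) / (n : ℝ≥0∞)) atTop

/-- The lower density of a subset of `[0, ∞)` with respect to Lebesgue measure. -/
noncomputable def realLowerDensity (B : Set ℝ) : ℝ≥0∞ :=
  liminf (fun t : ℝ => volume (B ∩ Icc 0 t) / ENNReal.ofReal t) atTop

/-- Frequent hypercyclicity of a single, not necessarily everywhere defined, (single-valued)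
operator given by its graph `T`: there is a vector `x = u 0` in the domain of all the powers of `T`
whose orbit `u n = T ^ n x` visits each non-empty open set with positive lower density. -/
def IsFrequentlyHypercyclicOp {X : Type*} [TopologicalSpace X] (T : Set (X × X)) : Prop :=
  ∃ u : ℕ → X, (∀ n, (u n, u (n + 1)) ∈ T) ∧
    ∀ V : Set X, IsOpen V → V.Nonempty → 0 < natLowerDensity {n | u n ∈ V}

/-- Frequent hypercyclicity of a family `(T t)_{t ≥ 0}` of (single-valued) operators given by their
graphs: there is a vector `x` in all the domains whose orbit `u t = T t x`, `t ≥ 0`, visits each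
non-empty open set with positive lower density. -/
def IsFrequentlyHypercyclicFamily {X : Type*} [TopologicalSpace X] (T : ℝ → Set (X × X)) : Prop :=
  ∃ (x : X) (u : ℝ → X), (∀ t, 0 ≤ t → (x, u t) ∈ T t) ∧
    ∀ V : Set X, IsOpen V → V.Nonempty → 0 < realLowerDensity {t | 0 ≤ t ∧ u t ∈ V}

/-- Frequent hypercyclicity of the `C`-regularized semigroup `(S t)_{t ≥ 0}` with subgenerator `A`:
some orbit `t ↦ C⁻¹ (S t x)` with `x ∈ Z₁(A)` visits each non-empty open set with positive lower
density. -/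
def IsFrequentlyHypercyclicSemigroup {E : Type*} [AddCommGroup E] [Module ℂ E] [TopologicalSpace E]
    (A : E →ₗ.[ℂ] E) (C : E →L[ℂ] E) (S : ℝ → E →L[ℂ] E) : Prop :=
  IsFrequentlyHypercyclicFamily (solutionOp A C S)

/-- `f` is analytic on `Ω`: near each point of `Ω` it is the sum of a power series with
coefficients in `E`. -/
def IsAnalyticMapOn {E : Type*} [AddCommGroup E] [Module ℂ E] [TopologicalSpace E]
    (f : ℂ → E) (Ω : Set ℂ) : Prop :=
  ∀ z ∈ Ω, ∃ (a : ℕ → E) (r : ℝ), 0 < r ∧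
    ∀ w ∈ Metric.ball z r, HasSum (fun n => (w - z) ^ n • a n) (f w)

/-! On the imaginary axis the solutions `e^{zt} f(z)` neither grow nor decay, but smooth
superpositions of them decay in both time directions. Near `z₀ ∈ Ω ∩ iℝ`, integrating `e^{(z₀+is)t}
f(z₀+is)` over `[-δ, δ]` against `(δ² - s²)² (is)^k` gives a mild solution on all of `ℝ` that is
`O(1/(1+t²))` in every seminorm: the weight vanishes doubly at `±δ`, so one can integrate by parts
twice (`norm_oscMoment_le`, `isRapidOrbit_momentOrbit`). No integral in `E` is needed for this: `f`
is expanded in its power series and only scalar moments are integrated.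

The values at `0` of such rapid orbits are dense in `F`, the closed span of `f(Ω)`. A functional `φ`
annihilating them has vanishing moments, so `φ ∘ f` vanishes on a vertical segment through `z₀` and,
by the identity theorem, on `Ω` (`closure_span_le_closure_rapidOrbitSubmodule`).

Let rapid orbits `Y l` run through a dense set, each infinitely often, and choose times `m (l, i)`
that have linear growth in `i` and are separated by more than a prescribed `K l`
(`exists_separated_positions`). The sum of all translates `Y l (t - T * m (l, i))` converges to a
complete orbit `u`, and near `T * m (l, i)` the other translates contribute little, so `u` is close
to the value of `Y l` at `0` (`exists_orbit_visiting_linearly_often`). Hence `u` visits every open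
set meeting `F` with positive lower density.

Finally, every mild solution `v` starting at `x` satisfies `C (v t) = S t x`
(`IsSubgenerator.apply_mildSolution`). As `C` is injective, mild solutions are unique, `u` stays in
`Z₁(A)`, and `u (s + t)` is the image of `u s` under `C⁻¹ S t`. The step `T = 1` serves the families
and `T = t₀` the single operators. -/

set_option linter.unusedSectionVars false

/-! ### Separated sequences of positive lower density -/

/-- A sequence of integers in which the `n`-th term is at distance more than the `2`-adic valuation
of `n` from all the other terms. -/
def spreadSeq (n : ℕ) : ℕ :=
  ∑ j ∈ Finset.range n, (padicValNat 2 j + 1) + ∑ j ∈ Finset.range (n + 1), (padicValNat 2 j + 1)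

/-- With `d j = padicValNat 2 j + 1`, the terms of `spreadSeq` are the midpoints of consecutive
intervals of lengths `2 * d j`, so two midpoints differ by at least the sum of the two half-lengths.
-/
theorem spreadSeq_add_le {n n' : ℕ} (h : n < n') :
    spreadSeq n + (padicValNat 2 n + 1) + (padicValNat 2 n' + 1) ≤ spreadSeq n' := by
  have h1 : ∑ j ∈ Finset.range (n + 1), (padicValNat 2 j + 1) ≤
      ∑ j ∈ Finset.range n', (padicValNat 2 j + 1) :=
    Finset.sum_le_sum_of_subset (Finset.range_mono h)
  have h2 := Finset.sum_range_succ (fun j => padicValNat 2 j + 1) n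
  have h3 := Finset.sum_range_succ (fun j => padicValNat 2 j + 1) n'
  unfold spreadSeq
  omega

theorem sum_range_padicValNat (p : ℕ) [Fact p.Prime] (n : ℕ) :
    ∑ j ∈ Finset.range (n + 1), padicValNat p j = padicValNat p n.factorial := by
  induction n with
  | zero => simp
  | succ n ih =>
    rw [Finset.sum_range_succ, ih, Nat.factorial_succ,
      padicValNat.mul (Nat.succ_ne_zero n) (Nat.factorial_ne_zero n), add_comm]

/-- By Legendre's formula the valuations of `1, …, n` add up to `v₂(n!) ≤ n`: large gaps are rare
enough to keep the growth linear. -/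
theorem spreadSeq_le (n : ℕ) : spreadSeq n ≤ 4 * n + 2 := by
  have h1 : ∑ j ∈ Finset.range (n + 1), (padicValNat 2 j + 1) ≤ 2 * n + 1 := by
    rw [Finset.sum_add_distrib, sum_range_padicValNat]
    have h2 := sub_one_mul_padicValNat_factorial (p := 2) n
    simp
    omega
  have h2 := Finset.sum_range_succ (fun j => padicValNat 2 j + 1) n
  unfold spreadSeq
  omega

theorem le_spreadSeq (n : ℕ) : padicValNat 2 n + 1 ≤ spreadSeq n := by
  have h2 := Finset.sum_range_succ (fun j => padicValNat 2 j + 1) n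
  unfold spreadSeq
  omega

theorem padicValNat_two_pow_mul_odd (r i : ℕ) : padicValNat 2 (2 ^ r * (2 * i + 1)) = r := by
  rw [padicValNat.mul (by positivity) (by positivity), padicValNat.prime_pow,
    padicValNat.eq_zero_of_not_dvd (by omega), add_zero]

/-- Row `l` uses the indices of `2`-adic valuation exactly `r l`. They form an arithmetic
progression, whence the linear growth; rows are disjoint because `r` is strictly increasing, and the
gaps exceed `r l ≥ K l`. -/
theorem exists_separated_positions (K : ℕ → ℕ) :
    ∃ m : ℕ × ℕ → ℕ, (∀ q, K q.1 < m q) ∧ (∀ q q', q ≠ q' → (K q.1 : ℤ) < |(m q : ℤ) - m q'|) ∧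
      ∀ l, ∃ L : ℕ, ∀ i, m (l, i) ≤ L * (i + 1) := by
  set r : ℕ → ℕ := fun l => l + ∑ j ∈ Finset.range (l + 1), K j with hr
  have hr_mono : StrictMono r := by
    refine strictMono_nat_of_lt_succ fun l => ?_
    simp only [hr, Finset.sum_range_succ _ (l + 1)]
    omega
  have hK : ∀ l, K l ≤ r l := fun l => by
    simp only [hr, Finset.sum_range_succ]
    omega
  have hinj : ∀ q q' : ℕ × ℕ, 2 ^ r q.1 * (2 * q.2 + 1) = 2 ^ r q'.1 * (2 * q'.2 + 1) → q = q' := by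
    rintro ⟨l, i⟩ ⟨l', i'⟩ h
    have h1 := congrArg (padicValNat 2) h
    rw [padicValNat_two_pow_mul_odd, padicValNat_two_pow_mul_odd] at h1
    have h2 : l = l' := hr_mono.injective h1
    subst h2
    have h3 := Nat.eq_of_mul_eq_mul_left (by positivity) h
    simp only [Prod.mk.injEq, true_and]
    simp only at h3
    omega
  refine ⟨fun q => spreadSeq (2 ^ r q.1 * (2 * q.2 + 1)), fun q => ?_, fun q q' hq => ?_,
    fun l => ⟨6 * 2 ^ r l * 2, fun i => ?_⟩⟩
  · have h1 := le_spreadSeq (2 ^ r q.1 * (2 * q.2 + 1))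
    rw [padicValNat_two_pow_mul_odd] at h1
    have := hK q.1
    simp only
    omega
  · have hne : 2 ^ r q.1 * (2 * q.2 + 1) ≠ 2 ^ r q'.1 * (2 * q'.2 + 1) := fun h => hq (hinj _ _ h)
    have := hK q.1
    beta_reduce
    rcases lt_or_gt_of_ne hne with h | h
    · have h1 := spreadSeq_add_le h
      rw [padicValNat_two_pow_mul_odd, padicValNat_two_pow_mul_odd] at h1
      rw [abs_sub_comm]
      refine lt_of_lt_of_le ?_ (le_abs_self _)
      omega
    · have h1 := spreadSeq_add_le h
      rw [padicValNat_two_pow_mul_odd, padicValNat_two_pow_mul_odd] at h1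
      refine lt_of_lt_of_le ?_ (le_abs_self _)
      omega
  · have h1 := spreadSeq_le (2 ^ r l * (2 * i + 1))
    have h2 : 1 ≤ 2 ^ r l := Nat.one_le_two_pow
    simp only
    nlinarith [Nat.zero_le (2 ^ r l * i)]

theorem natLowerDensity_pos_of_linear_growth {B : Set ℕ} {g : ℕ → ℕ} (hg : Function.Injective g)
    (h1 : ∀ i, 1 ≤ g i) {L : ℕ} (hL : ∀ i, g i ≤ L * (i + 1)) (hB : ∀ i, g i ∈ B) :
    0 < natLowerDensity B := by
  have hL0 : 1 ≤ L := by have := h1 0; have := hL 0; omega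
  have hpos : (0 : ℝ≥0∞) < ((2 * L : ℕ) : ℝ≥0∞)⁻¹ := by
    rw [ENNReal.inv_pos]; exact ENNReal.natCast_ne_top _
  refine lt_of_lt_of_le hpos ?_
  refine le_liminf_of_le (by isBoundedDefault) ?_
  filter_upwards [eventually_ge_atTop L] with n hn
  have hcard : n / L ≤ (B ∩ Icc 1 n).ncard := by
    have h2 : (g '' (Set.Iio (n / L))) ⊆ B ∩ Icc 1 n := by
      rintro _ ⟨i, hi, rfl⟩
      refine ⟨hB i, h1 i, (hL i).trans ?_⟩
      calc L * (i + 1) ≤ L * (n / L) := Nat.mul_le_mul_left _ hi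
        _ ≤ n := Nat.mul_div_le n L
    calc n / L = (g '' (Set.Iio (n / L))).ncard := by
          rw [Set.ncard_image_of_injective _ hg]; simp [Set.ncard_eq_toFinset_card']
      _ ≤ _ := Set.ncard_le_ncard h2 ((Set.finite_Icc 1 n).inter_of_right _)
  rw [ENNReal.le_div_iff_mul_le (Or.inl (by simp; omega)) (Or.inl (ENNReal.natCast_ne_top _)),
    mul_comm, ← div_eq_mul_inv, ENNReal.div_le_iff_le_mul
      (Or.inl (by simp; omega)) (Or.inl (ENNReal.natCast_ne_top _))]
  -- The factor `2` in the density bound `1 / (2 * L)` absorbs the rounding in `n / L`, which is at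
  -- least `1` here.
  have h3 : n < (n / L + 1) * L := Nat.lt_mul_of_div_lt (by omega) (by omega) |>.trans_le le_rfl
  have h4 : 1 ≤ n / L := (Nat.one_le_div_iff (by omega)).2 hn
  have : n ≤ (B ∩ Icc 1 n).ncard * (2 * L) := by nlinarith
  exact_mod_cast this

theorem realLowerDensity_pos_of_linear_growth {B : Set ℝ} {g : ℕ → ℕ} (hg : Function.Injective g)
    {L : ℕ} (hL0 : 1 ≤ L) (hL : ∀ i, g i ≤ L * (i + 1)) {δ : ℝ} (hδ : 0 < δ) (hδ1 : δ ≤ 1)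
    (hB : ∀ i, ∀ t ∈ Ico (g i : ℝ) (g i + δ), t ∈ B) :
    0 < realLowerDensity B := by
  have hL' : (1 : ℝ) ≤ L := by exact_mod_cast hL0
  have hpos : (0 : ℝ≥0∞) < ENNReal.ofReal (δ / (2 * L)) := by
    rw [ENNReal.ofReal_pos]; positivity
  refine lt_of_lt_of_le hpos ?_
  refine le_liminf_of_le (by isBoundedDefault) ?_
  filter_upwards [eventually_ge_atTop (2 + 2 * L : ℝ)] with t ht
  -- The `1` subtracted from `t` leaves room for the last interval, of length `δ ≤ 1`, inside `[0,
  -- t]`.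
  set N : ℕ := ⌊(t - 1) / L⌋₊ with hN
  have hN1 : (N : ℝ) ≤ (t - 1) / L := Nat.floor_le (div_nonneg (by linarith) (by linarith))
  have hN2 : t / (2 * L) ≤ N := by
    have h2 : (t - 1) / L < N + 1 := Nat.lt_floor_add_one _
    rw [div_lt_iff₀ (by linarith)] at h2
    rw [div_le_iff₀ (by linarith)]
    nlinarith
  have hsub : (⋃ i ∈ Finset.range N, Ico (g i : ℝ) (g i + δ)) ⊆ B ∩ Icc 0 t := by
    intro s hs
    simp only [mem_iUnion, Finset.mem_range] at hs
    obtain ⟨i, hi, hs⟩ := hs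
    refine ⟨hB i s hs, (Nat.cast_nonneg _).trans hs.1, ?_⟩
    have h3 : (g i : ℝ) ≤ L * (i + 1) := by exact_mod_cast hL i
    have h4 : (i : ℝ) + 1 ≤ N := by exact_mod_cast hi
    rw [le_div_iff₀ (by linarith)] at hN1
    have := hs.2
    nlinarith
  have hdisj : Set.PairwiseDisjoint (Finset.range N : Set ℕ) fun i => Ico (g i : ℝ) (g i + δ) := by
    intro i _ j _ hij
    have hne : g i ≠ g j := fun h => hij (hg h)
    rw [Function.onFun, Set.disjoint_left]
    rintro s ⟨h1, h2⟩ ⟨h3, h4⟩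
    rcases lt_or_gt_of_ne hne with h | h
    · have : (g i : ℝ) + 1 ≤ g j := by exact_mod_cast h
      linarith
    · have : (g j : ℝ) + 1 ≤ g i := by exact_mod_cast h
      linarith
  have hvol : ENNReal.ofReal (N * δ) ≤ volume (B ∩ Icc 0 t) := by
    refine le_trans (le_of_eq ?_) (measure_mono hsub)
    rw [measure_biUnion_finset hdisj fun _ _ => measurableSet_Ico]
    simp [Real.volume_Ico, ENNReal.ofReal_mul]
  have ht0 : 0 < t := by linarith
  rw [ENNReal.le_div_iff_mul_le (Or.inl (by simpa using ht0)) (Or.inl ENNReal.ofReal_ne_top),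
    ← ENNReal.ofReal_mul (by positivity)]
  refine le_trans (ENNReal.ofReal_le_ofReal ?_) hvol
  calc δ / (2 * L) * t = t / (2 * L) * δ := by ring
    _ ≤ N * δ := by gcongr

theorem Seminorm.sum_apply_le {E β : Type*} [AddCommGroup E] [Module ℂ E] (q : Seminorm ℂ E)
    (s : Finset β) (g : β → E) : q (∑ i ∈ s, g i) ≤ ∑ i ∈ s, q (g i) :=
  Finset.le_sum_of_subadditive q (map_zero q).le (map_add_le_add q) s g

/-! ### Seminorms, duality and weak integrals -/

section Duality

variable {E : Type*} [AddCommGroup E] [Module ℂ E] [TopologicalSpace E]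

theorem Submodule.mem_of_forall_dual_eq_zero [IsTopologicalAddGroup E] [ContinuousSMul ℂ E]
    [LocallyConvexSpace ℝ E] {F : Submodule ℂ E} (hF : IsClosed (F : Set E)) {x : E}
    (h : ∀ φ : E →L[ℂ] ℂ, (∀ y ∈ F, φ y = 0) → φ x = 0) : x ∈ F := by
  by_contra hx
  obtain ⟨φ, c, h1, h2⟩ := RCLike.geometric_hahn_banach_closed_point (𝕜 := ℂ) (s := (F : Set E))
    ((F.restrictScalars ℝ).convex) hF hx
  have hc : 0 < c := by simpa using h1 0 F.zero_mem
  have hφ : ∀ y ∈ F, φ y = 0 := by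
    intro y hy
    by_contra hne
    -- Rescaling `y` so that `φ` takes the value `c` contradicts the strict bound by `c` on `F`.
    have h3 := h1 (((c : ℂ) / φ y) • y) (F.smul_mem _ hy)
    rw [map_smul, smul_eq_mul, div_mul_cancel₀ _ hne] at h3
    simp at h3
  rw [h φ hφ] at h2
  simp at h2
  linarith

theorem Seminorm.exists_dual_eq [PolynormableSpace ℂ E] (q : Seminorm ℂ E)
    (hq : Continuous q) (y : E) : ∃ φ : E →L[ℂ] ℂ, φ y = q y ∧ ∀ x, ‖φ x‖ ≤ q x := by
  by_cases hy : y = 0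
  · exact ⟨0, by simp [hy], fun x => by simp⟩
  let e := (LinearEquiv.toSpanNonzeroSingleton ℂ E y hy).symm
  have he : ∀ x, e x • y = (x : E) := fun x =>
    LinearEquiv.toSpanNonzeroSingleton_symm_apply_smul ℂ E y hy x
  obtain ⟨φ, h1, h2⟩ := Module.Dual.exists_continuous_extension_of_le_seminorm (ℂ ∙ y)
    ((q y : ℂ) • e.toLinearMap) hq (fun x => by
      rw [← he x, map_smul_eq_mul]
      simp [abs_of_nonneg (apply_nonneg q y), mul_comm])
  refine ⟨φ, ?_, h2⟩
  have h3 := h1 ⟨y, Submodule.mem_span_singleton_self y⟩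
  have h4 : e ⟨y, Submodule.mem_span_singleton_self y⟩ = 1 := by
    simp only [e]
    rw [LinearEquiv.symm_apply_eq]
    ext
    simp
  simpa [h4] using h3

theorem eq_of_forall_dual_eq [PolynormableSpace ℂ E] [T2Space E] {x y : E}
    (h : ∀ φ : E →L[ℂ] ℂ, φ x = φ y) : x = y := by
  rw [← sub_eq_zero]
  by_contra hne
  obtain ⟨q, hq⟩ := (PolynormableSpace.withSeminorms ℂ E).separating_of_T1 _ hne
  obtain ⟨φ, h1, -⟩ := q.1.exists_dual_eq q.2 (x - y)
  rw [map_sub, h φ, sub_self] at h1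
  exact hq (by exact_mod_cast h1.symm)

end Duality

namespace HasVectorIntegral

variable {E : Type*} [AddCommGroup E] [Module ℂ E] [TopologicalSpace E]
  {u v : ℝ → E} {a b c : ℝ} {y z : E}

theorem unique [PolynormableSpace ℂ E] [T2Space E] (hy : HasVectorIntegral u a b y)
    (hz : HasVectorIntegral u a b z) : y = z :=
  eq_of_forall_dual_eq fun φ => (hy φ).2.trans (hz φ).2.symm

theorem seminorm_le [PolynormableSpace ℂ E] (hy : HasVectorIntegral u a b y) {q : Seminorm ℂ E}
    (hq : Continuous q) {M : ℝ} (hM : ∀ s ∈ uIcc a b, q (u s) ≤ M) : q y ≤ M * |b - a| := by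
  obtain ⟨φ, h1, h2⟩ := q.exists_dual_eq hq y
  have h3 : ‖∫ s in a..b, φ (u s)‖ ≤ M * |b - a| :=
    intervalIntegral.norm_integral_le_of_norm_le_const fun s hs =>
      (h2 _).trans (hM s (uIoc_subset_uIcc hs))
  rw [← (hy φ).2, h1] at h3
  simpa [abs_of_nonneg (apply_nonneg q y)] using h3

theorem add (hy : HasVectorIntegral u a b y) (hz : HasVectorIntegral v a b z) :
    HasVectorIntegral (u + v) a b (y + z) := fun φ => by
  refine ⟨by simpa using (hy φ).1.add (hz φ).1, ?_⟩
  simp only [Pi.add_apply, map_add]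
  rw [intervalIntegral.integral_add (hy φ).1 (hz φ).1, (hy φ).2, (hz φ).2]

theorem smul (k : ℂ) (hy : HasVectorIntegral u a b y) :
    HasVectorIntegral (k • u) a b (k • y) := fun φ => by
  refine ⟨by simpa using (hy φ).1.const_mul k, ?_⟩
  simp [(hy φ).2]

theorem congr (hy : HasVectorIntegral u a b y) (h : EqOn u v (uIcc a b)) :
    HasVectorIntegral v a b y := fun φ => by
  have h1 : EqOn (fun s => φ (u s)) (fun s => φ (v s)) (uIcc a b) := fun s hs => by simp [h hs]
  refine ⟨(hy φ).1.congr (h1.mono uIoc_subset_uIcc), ?_⟩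
  rw [(hy φ).2, intervalIntegral.integral_congr h1]

theorem sub_adjacent [IsTopologicalAddGroup E] (hz : HasVectorIntegral u a c z)
    (hy : HasVectorIntegral u a b y) : HasVectorIntegral u b c (z - y) := fun φ => by
  have h := (hy φ).1.symm.trans (hz φ).1
  refine ⟨h, ?_⟩
  rw [map_sub, (hy φ).2, (hz φ).2, sub_eq_iff_eq_add',
    intervalIntegral.integral_add_adjacent_intervals (hy φ).1 h]

theorem comp_add_right (d : ℝ) (hy : HasVectorIntegral u (a + d) (b + d) y) :
    HasVectorIntegral (fun s => u (s + d)) a b y := fun φ => by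
  refine ⟨?_, ?_⟩
  · have := (hy φ).1.comp_add_right d
    simpa using this
  · rw [(hy φ).2, intervalIntegral.integral_comp_add_right (fun s => φ (u s))]

theorem map {G : Type*} [AddCommGroup G] [Module ℂ G] [TopologicalSpace G]
    (hy : HasVectorIntegral u a b y) (T : E →L[ℂ] G) :
    HasVectorIntegral (fun s => T (u s)) a b (T y) := fun φ => hy (φ.comp T)

/-- Every functional vanishing on `F` vanishes on the integral, so Hahn–Banach applies. With the
graph of a closed operator as `F`, this lets the operator pass through the integral. -/
theorem mem_of_isClosed [IsTopologicalAddGroup E] [ContinuousSMul ℂ E] [LocallyConvexSpace ℝ E]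
    (hy : HasVectorIntegral u a b y) {F : Submodule ℂ E} (hF : IsClosed (F : Set E))
    (hu : ∀ s ∈ uIcc a b, u s ∈ F) : y ∈ F := by
  refine Submodule.mem_of_forall_dual_eq_zero hF fun φ hφ => ?_
  rw [(hy φ).2, intervalIntegral.integral_congr (g := fun _ => (0 : ℂ))
    fun s hs => hφ _ (hu s hs)]
  simp

theorem of_subtype [PolynormableSpace ℂ E] {F : Submodule ℂ E} {w : ℝ → F} {x : F}
    (h : HasVectorIntegral (fun s => (w s : E)) a b x) : HasVectorIntegral w a b x := fun φ => by
  obtain ⟨ψ, hψ⟩ := StrongDual.exists_extension F φ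
  have := h ψ
  simpa only [hψ] using this

theorem const_smul_of_scalar {g : ℝ → ℂ} (hg : IntervalIntegrable g volume a b) (x : E) :
    HasVectorIntegral (fun s => g s • x) a b ((∫ s in a..b, g s) • x) := fun φ => by
  refine ⟨by simpa using hg.mul_const (φ x), ?_⟩
  simp

end HasVectorIntegral

namespace WithSeminorms

variable {E : Type*} [AddCommGroup E] [Module ℂ E] {p : ℕ → Seminorm ℂ E} {β : Type*}

theorem seminorm_tsum_le [TopologicalSpace E] [T2Space E] (hp : WithSeminorms p) {g : β → E}
    (hg : Summable g) {k : ℕ} (hk : Summable fun i => p k (g i)) : p k (∑' i, g i) ≤ ∑' i, p k (g i) := by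
  have h1 : Tendsto (fun s : Finset β => p k (∑ i ∈ s, g i)) atTop (𝓝 (p k (∑' i, g i))) :=
    ((hp.continuous_seminorm k).tendsto _).comp hg.hasSum
  exact le_of_tendsto h1 (Eventually.of_forall fun s =>
    ((p k).sum_apply_le _ _).trans (hk.sum_le_tsum s fun i _ => apply_nonneg _ _))

theorem summable_of_seminorm [UniformSpace E] [IsUniformAddGroup E] [CompleteSpace E]
    (hp : WithSeminorms p) {g : β → E} (h : ∀ k, Summable fun i => p k (g i)) : Summable g := by
  rw [summable_iff_vanishing]
  intro e he
  obtain ⟨s, r, hr, hs⟩ := (hp.mem_nhds_iff 0 e).1 he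
  have h1 : ∀ k, ∃ t : Finset β, ∀ t', Disjoint t' t → p k (∑ i ∈ t', g i) < r := by
    intro k
    obtain ⟨t, ht⟩ := summable_iff_vanishing_norm.1 (h k) r hr
    exact ⟨t, fun t' hd => ((p k).sum_apply_le _ _).trans_lt
      ((le_abs_self _).trans_lt (ht t' hd))⟩
  choose t ht using h1
  classical
  refine ⟨s.biUnion t, fun t' hd => hs ?_⟩
  rw [Seminorm.mem_ball, sub_zero]
  refine Seminorm.finset_sup_apply_lt hr fun k hk => ht k t' ?_
  exact hd.mono_right (Finset.subset_biUnion_of_mem t hk)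

theorem exists_le_of_monotone [TopologicalSpace E] (hp : WithSeminorms p) (hmono : Monotone p)
    (q : Seminorm ℂ E) (hq : Continuous q) : ∃ (k : ℕ) (M : ℝ), 0 < M ∧ ∀ x, q x ≤ M * p k x := by
  obtain ⟨s, M, hM, h⟩ := Seminorm.bound_of_continuous hp q hq
  refine ⟨s.sup id, M, by positivity, fun x => (h x).trans ?_⟩
  rw [smul_apply, NNReal.smul_def, smul_eq_mul]
  gcongr
  exact Seminorm.finset_sup_apply_le (apply_nonneg _ _) fun i hi =>
    hmono (Finset.le_sup (f := id) hi) x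

theorem exists_ball_subset_of_monotone [TopologicalSpace E] (hp : WithSeminorms p)
    (hmono : Monotone p) {V : Set E} (hV : IsOpen V) {x : E} (hx : x ∈ V) :
    ∃ (k : ℕ) (r : ℝ), 0 < r ∧ ∀ y, p k (y - x) < r → y ∈ V := by
  obtain ⟨s, r, hr, h⟩ := (hp.mem_nhds_iff x V).1 (hV.mem_nhds hx)
  refine ⟨s.sup id, r, hr, fun y hy => h ?_⟩
  rw [Seminorm.mem_ball]
  exact Seminorm.finset_sup_apply_lt hr fun i hi =>
    (hmono (Finset.le_sup (f := id) hi) _).trans_lt hy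

end WithSeminorms

/-! ### Uniqueness of mild solutions -/

theorem hasDerivAt_integral_of_continuousOn_Ici {g : ℝ → ℂ} (hg : ContinuousOn g (Ici 0)) {t : ℝ}
    (ht : 0 < t) : HasDerivAt (fun r => ∫ s in (0 : ℝ)..r, g s) (g t) t := by
  -- Freezing `g` to the left of `0` makes it continuous on the whole line, without changing the
  -- integrals with positive endpoint.
  have hG : Continuous fun s => g (max s 0) :=
    hg.comp_continuous (by fun_prop) fun s => le_max_right s 0
  have h1 := (hG.integral_hasStrictDerivAt 0 t).hasDerivAt
  rw [max_eq_left ht.le] at h1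
  refine h1.congr_of_eventuallyEq ?_
  filter_upwards [eventually_gt_nhds ht] with r hr
  refine intervalIntegral.integral_congr fun s hs => ?_
  rw [uIcc_of_le hr.le] at hs
  simp [max_eq_left hs.1]

theorem HasVectorIntegral.prodMk {E G : Type*} [AddCommGroup E] [Module ℂ E] [TopologicalSpace E]
    [AddCommGroup G] [Module ℂ G] [TopologicalSpace G] {u : ℝ → E} {v : ℝ → G} {a b : ℝ} {y : E}
    {z : G} (hy : HasVectorIntegral u a b y) (hz : HasVectorIntegral v a b z) :
    HasVectorIntegral (fun s => (u s, v s)) a b (y, z) := fun φ => by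
  have h1 := hy (φ.comp (ContinuousLinearMap.inl ℂ E G))
  have h2 := hz (φ.comp (ContinuousLinearMap.inr ℂ E G))
  have h3 : ∀ (x : E) (x' : G), φ (x, x') =
      φ.comp (ContinuousLinearMap.inl ℂ E G) x + φ.comp (ContinuousLinearMap.inr ℂ E G) x' :=
    fun x x' => by simp [← map_add]
  simp only [h3]
  exact ⟨h1.1.add h2.1, by rw [intervalIntegral.integral_add h1.1 h2.1, h1.2, h2.2]⟩

theorem LinearPMap.graph_snd_unique {E : Type*} [AddCommGroup E] [Module ℂ E] {A : E →ₗ.[ℂ] E}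
    {x y z : E} (hy : (x, y) ∈ A.graph) (hz : (x, z) ∈ A.graph) : y = z :=
  A.mem_graph_snd_inj hy hz rfl

theorem IsMildSolution.apply_zero {E : Type*} [AddCommGroup E] [Module ℂ E] [TopologicalSpace E]
    [PolynormableSpace ℂ E] [T2Space E] {A : E →ₗ.[ℂ] E} {x : E} {v : ℝ → E}
    (hv : IsMildSolution A x v) : v 0 = x := by
  obtain ⟨y, hy, hg⟩ := hv.2 0 le_rfl
  have h0 : y = 0 := hy.unique fun φ => by simp
  subst h0
  exact sub_eq_zero.1 (A.graph_fst_eq_zero_snd hg rfl)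

namespace IsSubgenerator

section

variable {E : Type*} [AddCommGroup E] [Module ℂ E] [TopologicalSpace E] [IsTopologicalAddGroup E]
  [ContinuousSMul ℂ E] [PolynormableSpace ℂ E] [LocallyConvexSpace ℝ E] [T2Space E]
  {A : E →ₗ.[ℂ] E} {C : E →L[ℂ] E} {S : ℝ → E →L[ℂ] E}

theorem apply_zero (hS : IsSubgenerator A C S) (x : E) : S 0 x = C x := by
  obtain ⟨y, hy, hg⟩ := hS.integral 0 le_rfl x
  have h0 : y = 0 := hy.unique fun φ => by simp
  subst h0
  exact sub_eq_zero.1 (A.graph_fst_eq_zero_snd hg rfl)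

/-- Closedness of `A` makes the integral of `S s z` an image under `A` of the integral of `S s y`;
the defining identity of the semigroup evaluates that image as `S t y - C y`. -/
theorem hasVectorIntegral_of_mem_graph (hS : IsSubgenerator A C S) {y z : E}
    (h : (y, z) ∈ A.graph) {t : ℝ} (ht : 0 ≤ t) :
    HasVectorIntegral (fun s => S s z) 0 t (S t y - C y) := by
  obtain ⟨Y, hY, hYg⟩ := hS.integral t ht y
  obtain ⟨Z, hZ, -⟩ := hS.integral t ht z
  have h1 : (Y, Z) ∈ A.graph := (hY.prodMk hZ).mem_of_isClosed hS.isClosed fun s hs => by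
    rw [uIcc_of_le ht] at hs
    exact hS.commute_op s hs.1 y z h
  rwa [LinearPMap.graph_snd_unique hYg h1]

theorem hasDerivAt_of_mem_graph (hS : IsSubgenerator A C S) {y z : E} (h : (y, z) ∈ A.graph)
    {t : ℝ} (ht : 0 < t) (φ : E →L[ℂ] ℂ) :
    HasDerivAt (fun s => φ (S s y)) (φ (S t z)) t := by
  have h1 := hasDerivAt_integral_of_continuousOn_Ici
    (φ.continuous.comp_continuousOn (hS.continuousOn z)) ht
  refine (h1.add_const (φ (C y))).congr_of_eventuallyEq ?_
  filter_upwards [eventually_gt_nhds ht] with r hr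
  have h2 := ((hS.hasVectorIntegral_of_mem_graph h hr.le) φ).2
  rw [map_sub] at h2
  simp only [Function.comp_def]
  rw [← h2, sub_add_cancel]

end

variable {E : Type*} [AddCommGroup E] [Module ℂ E] [UniformSpace E] [IsUniformAddGroup E]
  [ContinuousSMul ℂ E] [BarrelledSpace ℂ E] [PolynormableSpace ℂ E] [LocallyConvexSpace ℝ E]
  [T2Space E] {A : E →ₗ.[ℂ] E} {C : E →L[ℂ] E} {S : ℝ → E →L[ℂ] E}

/-- This is the uniform boundedness principle: in a barrelled space the supremum of a pointwise
bounded family of continuous seminorms is continuous. It supplies the joint continuity of `(σ, y) ↦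
φ (S σ y)` on compact time intervals. -/
theorem exists_seminorm_bound (hS : IsSubgenerator A C S) (φ : E →L[ℂ] ℂ) (T : ℝ) :
    ∃ q : Seminorm ℂ E, Continuous q ∧ ∀ t ∈ Icc 0 T, ∀ y, ‖φ (S t y)‖ ≤ q y := by
  let P : Icc (0 : ℝ) T → Seminorm ℂ E := fun t =>
    (normSeminorm ℂ ℂ).comp (φ.comp (S t)).toLinearMap
  have hbdd : BddAbove (range P) := by
    rw [Seminorm.bddAbove_range_iff]
    intro x
    have hc : ContinuousOn (fun t => ‖φ (S t x)‖) (Icc 0 T) :=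
      ((φ.continuous.comp_continuousOn (hS.continuousOn x)).norm).mono Icc_subset_Ici_self
    refine (isCompact_Icc.bddAbove_image hc).mono ?_
    rintro _ ⟨t, rfl⟩
    exact ⟨t, t.2, rfl⟩
  refine ⟨⨆ t, P t, ?_, fun t ht y => ?_⟩
  · rw [Seminorm.coe_iSup_eq hbdd]
    exact Seminorm.continuous_iSup P (fun t => (φ.comp (S t)).continuous.norm) hbdd
  · exact le_ciSup hbdd ⟨t, ht⟩ y

theorem tendsto_apply (hS : IsSubgenerator A C S) (φ : E →L[ℂ] ℂ) {T : ℝ} {ι : Type*}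
    {l : Filter ι} {σ : ι → ℝ} {y : ι → E} {σ₀ : ℝ} {y₀ : E} (hσ : Tendsto σ l (𝓝 σ₀))
    (hσT : ∀ᶠ i in l, σ i ∈ Icc 0 T) (hσ₀ : 0 ≤ σ₀) (hy : Tendsto y l (𝓝 y₀)) :
    Tendsto (fun i => φ (S (σ i) (y i))) l (𝓝 (φ (S σ₀ y₀))) := by
  obtain ⟨q, hq, hb⟩ := hS.exists_seminorm_bound φ T
  have h1 : Tendsto (fun i => φ (S (σ i) y₀)) l (𝓝 (φ (S σ₀ y₀))) := by
    refine (φ.continuous.comp_continuousOn (hS.continuousOn y₀) σ₀ hσ₀).tendsto.comp ?_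
    exact tendsto_nhdsWithin_iff.2 ⟨hσ, hσT.mono fun i hi => hi.1⟩
  have h2 : Tendsto (fun i => q (y i - y₀)) l (𝓝 0) := by
    have := (hq.tendsto 0).comp (tendsto_sub_nhds_zero_iff.2 hy)
    simpa [Function.comp_def] using this
  have h3 : Tendsto (fun i => φ (S (σ i) (y i - y₀))) l (𝓝 0) :=
    squeeze_zero_norm' (hσT.mono fun i hi => hb _ hi _) h2
  simpa using h3.add h1

/-- Let `w` be the primitive of `v` with `w 0 = 0`, so that `A w = v - x`. The derivative of `s ↦ S
(r - s) (w s)` is `-S (r - s) (A w s) + S (r - s) (v s) = S (r - s) x`. Integrating over `[0, r]`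
shows that `C (w r)` is the integral of `S s x`, and differentiating in `r` gives the claim.
Derivatives of `S` are taken only after applying a functional. -/
theorem apply_mildSolution (hS : IsSubgenerator A C S) {x : E} {v : ℝ → E}
    (hv : IsMildSolution A x v) {t : ℝ} (ht : 0 ≤ t) : C (v t) = S t x := by
  obtain ⟨hvc, hvi⟩ := hv
  choose! w hw hwg using hvi
  have hsub : ∀ s s', 0 ≤ s → 0 ≤ s' → HasVectorIntegral v s s' (w s' - w s) :=
    fun s s' hs hs' => (hw s' hs').sub_adjacent (hw s hs)
  -- `w` is continuous and differentiable with derivative `v`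
  have hslope : ∀ s, 0 < s →
      Tendsto (fun s' : ℝ => ((s' - s : ℝ) : ℂ)⁻¹ • (w s' - w s)) (𝓝[≠] s) (𝓝 (v s)) := by
    intro s hs
    rw [(PolynormableSpace.withSeminorms ℂ E).tendsto_nhds]
    rintro ⟨q, hq⟩ ε hε
    have hva : ContinuousAt v s := hvc.continuousAt (Ici_mem_nhds hs)
    have h1 : ∀ᶠ r in 𝓝 s, q (v r - v s) < ε / 2 := by
      have : Tendsto (fun r => q (v r - v s)) (𝓝 s) (𝓝 0) := by
        simpa [Function.comp_def] using (hq.tendsto 0).comp (tendsto_sub_nhds_zero_iff.2 hva)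
      exact this.eventually_lt_const (half_pos hε)
    obtain ⟨δ, hδ, h2⟩ := Metric.eventually_nhds_iff.1 h1
    have h3 : ∀ᶠ s' in 𝓝[≠] s, dist s' s < δ ∧ 0 < s' :=
      ((Metric.eventually_nhds_iff.2 ⟨δ, hδ, fun _ h => h⟩).and
        (eventually_gt_nhds hs)).filter_mono nhdsWithin_le_nhds
    filter_upwards [h3, self_mem_nhdsWithin] with s' hs' hne
    have hne' : s' - s ≠ 0 := sub_ne_zero.2 hne
    have h4 : HasVectorIntegral (fun r => v r - v s) s s' (w s' - w s - ((s' - s : ℝ) : ℂ) • v s) := by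
      have h5 := (HasVectorIntegral.const_smul_of_scalar (a := s) (b := s') (g := fun _ => (1 : ℂ))
        intervalIntegrable_const (v s)).smul (-1)
      have h6 := (hsub s s' hs.le hs'.2.le).add h5
      convert! h6 using 1
      · ext r; simp [sub_eq_add_neg]
      · simp [sub_eq_add_neg]
    have h7 := h4.seminorm_le hq (M := ε / 2) fun r hr => by
      refine (h2 ?_).le
      rw [Real.dist_eq]
      exact (abs_sub_left_of_mem_uIcc hr).trans_lt hs'.1
    change q _ < ε
    have h8 : ((s' - s : ℝ) : ℂ)⁻¹ • (w s' - w s) - v s =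
        ((s' - s : ℝ) : ℂ)⁻¹ • (w s' - w s - ((s' - s : ℝ) : ℂ) • v s) := by
      rw [smul_sub _ (w s' - w s), smul_smul, inv_mul_cancel₀ (by exact_mod_cast hne'), one_smul]
    rw [h8, map_smul_eq_mul, norm_inv, Complex.norm_real, Real.norm_eq_abs,
      inv_mul_lt_iff₀ (abs_pos.2 hne')]
    nlinarith [abs_pos.2 hne']
  have hwc : ∀ T, ContinuousOn w (Icc 0 T) := by
    intro T s hs
    rw [ContinuousWithinAt, (PolynormableSpace.withSeminorms ℂ E).tendsto_nhds]
    rintro ⟨q, hq⟩ ε hε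
    obtain ⟨M, hM⟩ := isCompact_Icc.bddAbove_image
      (hq.comp_continuousOn (hvc.mono (Icc_subset_Ici_self (a := T) (b := 0))))
    have hM0 : ∀ r ∈ Icc 0 T, q (v r) ≤ |M| + 1 := fun r hr =>
      (hM ⟨r, hr, rfl⟩).trans ((le_abs_self M).trans (by linarith))
    have h1 : ∀ᶠ s' in 𝓝 s, dist s' s < ε / (|M| + 1) :=
      Metric.eventually_nhds_iff.2 ⟨_, by positivity, fun _ h => h⟩
    filter_upwards [nhdsWithin_le_nhds h1, self_mem_nhdsWithin] with s' hs1 hs2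
    have h2 := (hsub s s' hs.1 hs2.1).seminorm_le hq (M := |M| + 1) fun r hr =>
      hM0 r (uIcc_subset_Icc hs hs2 hr)
    change q _ < ε
    refine h2.trans_lt ?_
    rw [Real.dist_eq, lt_div_iff₀ (by positivity)] at hs1
    linarith
  -- the derivative of `s ↦ S (r - s) (w s)` is `S (r - s) x`
  have key : ∀ r, 0 ≤ r → HasVectorIntegral (fun s => S s x) 0 r (C (w r)) := by
    intro r hr φ
    have hxc : ContinuousOn (fun s => φ (S s x)) (Icc 0 r) :=
      (φ.continuous.comp_continuousOn (hS.continuousOn x)).mono Icc_subset_Ici_self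
    refine ⟨ContinuousOn.intervalIntegrable (by rwa [uIcc_of_le hr]), ?_⟩
    have hcont : ContinuousOn (fun s => φ (S (r - s) (w s))) (Icc 0 r) := fun s hs => by
      refine hS.tendsto_apply φ (T := r) ?_ ?_ (by linarith [hs.2]) (hwc r s hs)
      · exact ((continuous_const.sub continuous_id).tendsto s).mono_left nhdsWithin_le_nhds
      · filter_upwards [self_mem_nhdsWithin] with s' hs'
        exact ⟨by linarith [hs'.2], by linarith [hs'.1]⟩
    have hderiv : ∀ s ∈ Ioo 0 r, HasDerivAt (fun s => φ (S (r - s) (w s))) (φ (S (r - s) x)) s := by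
      intro s hs
      rw [hasDerivAt_iff_tendsto_slope]
      have h1 := (hS.hasDerivAt_of_mem_graph (hwg s hs.1.le) (sub_pos.2 hs.2) φ).scomp s
        ((hasDerivAt_id s).const_sub r)
      rw [hasDerivAt_iff_tendsto_slope] at h1
      have hev : ∀ᶠ s' in 𝓝[≠] s, s' ∈ Ioo 0 r :=
        nhdsWithin_le_nhds (Ioo_mem_nhds hs.1 hs.2)
      -- Product rule: the slope splits into `S (r - s')` applied to the slope of `w`, whose limit
      -- needs joint continuity, and the slope of `S (r - ·)` at the fixed vector `w s`, which is
      -- `h1`.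
      have h2 := hS.tendsto_apply φ (T := r) (l := 𝓝[≠] s) (σ := fun s' => r - s')
        (((continuous_const.sub continuous_id).tendsto s).mono_left nhdsWithin_le_nhds)
        (hev.mono fun s' hs' => ⟨by linarith [hs'.2], by linarith [hs'.1]⟩)
        (sub_nonneg.2 hs.2.le) (hslope s hs.1)
      have h3 := h2.add h1
      have h4 : φ (S (r - id s) (v s)) + (-1 : ℝ) • φ (S (r - id s) (v s - x)) =
          φ (S (r - s) x) := by simp
      simp only [Pi.sub_apply, id] at h3 h4
      rw [h4] at h3
      refine h3.congr' ?_
      filter_upwards [self_mem_nhdsWithin] with s' hne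
      simp only [slope, vsub_eq_sub, Function.comp_def, map_smul, map_sub, smul_eq_mul,
        Complex.real_smul, Complex.ofReal_inv]
      ring
    have hxc' : ContinuousOn (fun s => φ (S (r - s) x)) (Icc 0 r) :=
      hxc.comp (by fun_prop) fun s hs => ⟨by linarith [hs.2], by linarith [hs.1]⟩
    have h5 := intervalIntegral.integral_eq_sub_of_hasDerivAt_of_le hr hcont hderiv
      (ContinuousOn.intervalIntegrable (by rwa [uIcc_of_le hr]))
    rw [intervalIntegral.integral_comp_sub_left (fun s => φ (S s x)) r] at h5
    have hw0 : w 0 = 0 := (hw 0 le_rfl).unique fun φ => by simp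
    simp only [sub_self, sub_zero, hw0, map_zero, hS.apply_zero] at h5
    exact h5.symm
  rcases ht.eq_or_lt with rfl | ht
  · rw [hS.apply_zero, IsMildSolution.apply_zero ⟨hvc, fun t ht => ⟨w t, hw t ht, hwg t ht⟩⟩]
  refine eq_of_forall_dual_eq fun φ => ?_
  have h1 := hasDerivAt_integral_of_continuousOn_Ici
    (φ.continuous.comp_continuousOn (hS.continuousOn x)) ht
  have h2 := hasDerivAt_integral_of_continuousOn_Ici
    ((φ.comp C).continuous.comp_continuousOn hvc) ht
  refine h2.unique (h1.congr_of_eventuallyEq ?_)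
  filter_upwards [eventually_gt_nhds ht] with r hr
  have h3 := (key r hr.le φ).2
  have h4 := (hw r hr.le (φ.comp C)).2
  simp only [Function.comp_def, ContinuousLinearMap.comp_apply] at h3 h4 ⊢
  rw [← h3, ← h4]

theorem mem_mildSolutionSpace (hS : IsSubgenerator A C S) {x : E} {u : ℝ → E}
    (hu : IsMildSolution A x u) : x ∈ mildSolutionSpace A :=
  ⟨u, hu, fun _ hv _ ht => hS.injective
    ((hS.apply_mildSolution hv ht).trans (hS.apply_mildSolution hu ht).symm)⟩

theorem mem_solutionOp (hS : IsSubgenerator A C S) {x : E} {u : ℝ → E}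
    (hu : IsMildSolution A x u) {t : ℝ} (ht : 0 ≤ t) : (x, u t) ∈ solutionOp A C S t :=
  ⟨hS.mem_mildSolutionSpace hu, hS.apply_mildSolution hu ht⟩

/-- The function `e^{zt} x` is a mild solution, so `apply_mildSolution` identifies it. -/
theorem apply_eigenvector (hS : IsSubgenerator A C S) {z : ℂ} {x : E}
    (h : (x, z • x) ∈ A.graph) {t : ℝ} (ht : 0 ≤ t) : S t x = Complex.exp (z * t) • C x := by
  have hd : ∀ s : ℝ, HasDerivAt (fun s : ℝ => Complex.exp (z * s)) (Complex.exp (z * s) * z) s :=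
    fun s => by simpa using ((Complex.ofRealCLM.hasDerivAt (x := s)).const_mul z).cexp
  have hc : Continuous fun s : ℝ => Complex.exp (z * s) := by fun_prop
  have hu : IsMildSolution A x fun s => Complex.exp (z * s) • x := by
    refine ⟨(by fun_prop : Continuous fun s : ℝ => Complex.exp (z * s) • x).continuousOn,
      fun r _ => ⟨_, HasVectorIntegral.const_smul_of_scalar (hc.intervalIntegrable 0 r) x, ?_⟩⟩
    have h1 := intervalIntegral.integral_eq_sub_of_hasDerivAt (fun s _ => hd s)
      ((hc.mul_const z).intervalIntegrable 0 r)
    rw [intervalIntegral.integral_mul_const] at h1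
    have h2 := A.graph.smul_mem (∫ s in (0 : ℝ)..r, Complex.exp (z * s)) h
    convert! h2 using 1
    rw [Prod.smul_mk, smul_smul, h1]
    simp [sub_smul]
  rw [← hS.apply_mildSolution hu ht, map_smul]

end IsSubgenerator

/-! ### Oscillatory moments -/

/-- The weight `(δ² - s²)²`, times `(i s) ^ j`. -/
noncomputable def momentWeight (δ : ℝ) (j : ℕ) (s : ℝ) : ℂ :=
  ((δ : ℂ) ^ 2 - (s : ℂ) ^ 2) ^ 2 * (Complex.I * s) ^ j

/-- The moment `∫_{-δ}^{δ} (δ² - s²)² (i s)^j e^{(z₀ + i s) t} ds`. -/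
noncomputable def oscMoment (z₀ : ℂ) (δ : ℝ) (j : ℕ) (t : ℝ) : ℂ :=
  ∫ s in (-δ)..δ, momentWeight δ j s * Complex.exp ((z₀ + Complex.I * s) * t)

@[fun_prop]
theorem continuous_momentWeight (δ : ℝ) (j : ℕ) : Continuous (momentWeight δ j) := by
  unfold momentWeight
  fun_prop

theorem momentWeight_succ (δ : ℝ) (j : ℕ) (s : ℝ) :
    momentWeight δ (j + 1) s = momentWeight δ j s * (Complex.I * s) := by
  simp only [momentWeight, pow_succ]
  ring

theorem norm_exp_mul_ofReal_of_re_eq_zero {z : ℂ} (hz : z.re = 0) (t : ℝ) :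
    ‖Complex.exp (z * t)‖ = 1 := by
  simp [Complex.norm_exp, hz]

/-- Differentiation brings down `z₀ + is`, and the factor `is` raises the index of the moment. This
matches the action `a n ↦ z₀ • a n + a (n - 1)` of `A` on the power series coefficients of `f`, see
`coeff_mem_graph`. -/
theorem hasDerivAt_oscMoment {z₀ : ℂ} (hz : z₀.re = 0) (δ : ℝ) (j : ℕ) (t : ℝ) :
    HasDerivAt (oscMoment z₀ δ j) (z₀ * oscMoment z₀ δ j t + oscMoment z₀ δ (j + 1) t) t := by
  have hre : ∀ s : ℝ, (z₀ + Complex.I * s).re = 0 := fun s => by simp [hz]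
  have hd : ∀ s r : ℝ, HasDerivAt
      (fun r : ℝ => momentWeight δ j s * Complex.exp ((z₀ + Complex.I * s) * r))
      (momentWeight δ j s * (Complex.exp ((z₀ + Complex.I * s) * r) * (z₀ + Complex.I * s))) r :=
    fun s r => by
      simpa using (((Complex.ofRealCLM.hasDerivAt (x := r)).const_mul
        (z₀ + Complex.I * s)).cexp).const_mul (momentWeight δ j s)
  have hc : ∀ r : ℝ, Continuous fun s : ℝ =>
      momentWeight δ j s * Complex.exp ((z₀ + Complex.I * s) * r) := fun r => by fun_prop
  have h := (intervalIntegral.hasDerivAt_integral_of_dominated_loc_of_deriv_le (𝕜 := ℝ) (μ := volume)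
    (a := -δ) (b := δ) (s := univ) (x₀ := t)
    (F := fun (r s : ℝ) => momentWeight δ j s * Complex.exp ((z₀ + Complex.I * s) * r))
    (F' := fun (r s : ℝ) => momentWeight δ j s *
      (Complex.exp ((z₀ + Complex.I * s) * r) * (z₀ + Complex.I * s)))
    (bound := fun s => ‖momentWeight δ j s‖ * ‖z₀ + Complex.I * s‖) univ_mem
    (Eventually.of_forall fun r => (hc r).aestronglyMeasurable)
    ((hc t).intervalIntegrable _ _)
    (Continuous.aestronglyMeasurable (by fun_prop))
    (Eventually.of_forall fun s _ r _ => by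
      rw [norm_mul, norm_mul, norm_exp_mul_ofReal_of_re_eq_zero (hre s), one_mul])
    (Continuous.intervalIntegrable (by fun_prop) _ _)
    (Eventually.of_forall fun s _ r _ => hd s r)).2
  refine h.congr_deriv ?_
  unfold oscMoment
  rw [← intervalIntegral.integral_const_mul, ← intervalIntegral.integral_add
    (Continuous.intervalIntegrable (by fun_prop) _ _)
    (Continuous.intervalIntegrable (by fun_prop) _ _)]
  refine intervalIntegral.integral_congr fun s _ => ?_
  simp only [momentWeight_succ]
  ring

theorem continuous_oscMoment {z₀ : ℂ} (hz : z₀.re = 0) (δ : ℝ) (j : ℕ) :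
    Continuous (oscMoment z₀ δ j) :=
  continuous_iff_continuousAt.2 fun t => (hasDerivAt_oscMoment hz δ j t).continuousAt

theorem integral_oscMoment {z₀ : ℂ} (hz : z₀.re = 0) (δ : ℝ) (j : ℕ) (a b : ℝ) :
    z₀ * (∫ t in a..b, oscMoment z₀ δ j t) + ∫ t in a..b, oscMoment z₀ δ (j + 1) t =
      oscMoment z₀ δ j b - oscMoment z₀ δ j a := by
  have hc := continuous_oscMoment hz δ
  rw [← intervalIntegral.integral_const_mul, ← intervalIntegral.integral_add
    (((hc j).const_mul _).intervalIntegrable _ _) ((hc (j + 1)).intervalIntegrable _ _)]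
  exact intervalIntegral.integral_eq_sub_of_hasDerivAt
    (fun t _ => hasDerivAt_oscMoment hz δ j t)
    ((((hc j).const_mul _).add (hc (j + 1))).intervalIntegrable _ _)

/-- Integrating twice by parts against `e^{ist}`. -/
theorem integral_mul_exp_eq_of_hasDerivAt {G G' G'' : ℝ → ℂ} {a b : ℝ}
    (h1 : ∀ s, HasDerivAt G (G' s) s) (h2 : ∀ s, HasDerivAt G' (G'' s) s) (hc : Continuous G'')
    (ha : G a = 0) (hb : G b = 0) (ha' : G' a = 0) (hb' : G' b = 0) (t : ℝ) :
    (t : ℂ) ^ 2 * (∫ s in a..b, G s * Complex.exp (Complex.I * s * t)) =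
      -∫ s in a..b, G'' s * Complex.exp (Complex.I * s * t) := by
  have he : ∀ s : ℝ, HasDerivAt (fun s : ℝ => Complex.exp (Complex.I * s * t))
      (Complex.exp (Complex.I * s * t) * (Complex.I * t)) s := fun s => by
    simpa using (((Complex.ofRealCLM.hasDerivAt (x := s)).const_mul Complex.I).mul_const (t : ℂ)).cexp
  have hG'c : Continuous G' := continuous_iff_continuousAt.2 fun s => (h2 s).continuousAt
  have hec : Continuous fun s : ℝ => Complex.exp (Complex.I * s * t) * (Complex.I * t) := by fun_prop
  have i1 := intervalIntegral.integral_mul_deriv_eq_deriv_mul (a := a) (b := b)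
    (fun s _ => h1 s) (fun s _ => he s) (hG'c.intervalIntegrable _ _) (hec.intervalIntegrable _ _)
  have i2 := intervalIntegral.integral_mul_deriv_eq_deriv_mul (a := a) (b := b)
    (fun s _ => h2 s) (fun s _ => he s) (hc.intervalIntegrable _ _) (hec.intervalIntegrable _ _)
  simp only [ha, hb, ha', hb', zero_mul, sub_zero, zero_sub, ← mul_assoc,
    intervalIntegral.integral_mul_const] at i1 i2
  have hI := Complex.I_sq
  linear_combination ((t : ℂ) ^ 2 * ∫ s in a..b, G s * Complex.exp (Complex.I * s * t)) * hI
    - (Complex.I * t) * i1 + i2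

/-- The bound on the derivative of a power is multiplied through by `δ`, so that truncated
subtraction at `j = 0` does no harm. -/
theorem norm_natCast_mul_pow_sub_one_mul_le {w : ℂ} {δ : ℝ} (hw : ‖w‖ ≤ δ) (j : ℕ) :
    ‖(j : ℂ) * w ^ (j - 1)‖ * δ ≤ j * δ ^ j := by
  have hδ : 0 ≤ δ := (norm_nonneg w).trans hw
  rcases j with _ | j
  · simp
  · rw [norm_mul, norm_pow, Complex.norm_natCast, Nat.add_sub_cancel, pow_succ, ← mul_assoc]
    gcongr

/-- Since `|e^{z₀t}| = 1`, only the integral of `G s * e^{ist}` matters. A direct estimate gives `2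
δ^j`, and two integrations by parts bound `t²` times it by `24 (j+1)² δ^j`; the sum is below the
constant `30`. The factor `δ^j` is what later beats the growth of the coefficients of `f`. -/
theorem norm_oscMoment_le {z₀ : ℂ} (hz : z₀.re = 0) {δ : ℝ} (hδ0 : 0 < δ) (hδ1 : δ ≤ 1) (j : ℕ)
    (t : ℝ) : ‖oscMoment z₀ δ j t‖ ≤ 30 * ((j : ℝ) + 1) ^ 2 * δ ^ j / (1 + t ^ 2) := by
  set w : ℝ → ℂ := fun s => (δ : ℂ) ^ 2 - (s : ℂ) ^ 2 with hw
  set q : ℝ → ℂ := fun s => Complex.I * s with hq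
  have hwd : ∀ s : ℝ, HasDerivAt w (-2 * s) s := fun s => by
    have := ((Complex.ofRealCLM.hasDerivAt (x := s)).pow 2).const_sub ((δ : ℂ) ^ 2)
    simpa [hw] using this
  have hqd : ∀ s, HasDerivAt q Complex.I s := fun s => by
    simpa [hq] using (Complex.ofRealCLM.hasDerivAt (x := s)).const_mul Complex.I
  set G : ℝ → ℂ := fun s => w s ^ 2 * q s ^ j with hG
  set G' : ℝ → ℂ := fun s =>
    2 * w s * (-2 * s) * q s ^ j + w s ^ 2 * (j * q s ^ (j - 1) * Complex.I) with hG'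
  -- For `j = 0` and `j = 1` the truncated exponents are harmless, since the factors `j` and `(j - 1
  -- : ℕ)` vanish.
  set G'' : ℝ → ℂ := fun s =>
    (8 * s ^ 2 - 4 * w s) * q s ^ j + 2 * (2 * w s * (-2 * s)) * (j * q s ^ (j - 1) * Complex.I)
      + w s ^ 2 * (j * ((j - 1 : ℕ) * q s ^ (j - 1 - 1) * Complex.I) * Complex.I) with hG''
  have h1 : ∀ s, HasDerivAt G (G' s) s := fun s => by
    refine (((hwd s).pow 2).mul ((hqd s).pow j)).congr_deriv ?_
    simp [hG']
  have h2 : ∀ s, HasDerivAt G' (G'' s) s := fun s => by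
    have hs : HasDerivAt (fun s : ℝ => (-2 * s : ℂ)) (-2) s := by
      simpa using (Complex.ofRealCLM.hasDerivAt (x := s)).const_mul (-2 : ℂ)
    refine (((((hwd s).const_mul 2).mul hs).mul ((hqd s).pow j)).add
      (((hwd s).pow 2).mul ((((hqd s).pow (j - 1)).const_mul (j : ℂ)).mul_const
        Complex.I))).congr_deriv ?_
    simp only [hG'', Pi.mul_apply, Pi.pow_apply]
    push_cast
    ring
  have hc : Continuous G'' := by
    simp only [hG'', hw, hq]
    fun_prop
  have hwδ : w δ = 0 ∧ w (-δ) = 0 := by simp [hw]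
  have hexp : ∀ s : ℝ, ‖Complex.exp (Complex.I * s * t)‖ = 1 := fun s =>
    norm_exp_mul_ofReal_of_re_eq_zero (by simp) t
  have hs : ∀ s ∈ uIoc (-δ) δ, |s| ≤ δ := fun s hs => by
    rw [uIoc_of_le (by linarith)] at hs
    exact abs_le.2 ⟨hs.1.le, hs.2⟩
  have hwb : ∀ s : ℝ, |s| ≤ δ → ‖w s‖ ≤ δ ^ 2 := fun s hs => by
    have e : w s = ((δ ^ 2 - s ^ 2 : ℝ) : ℂ) := by simp [hw]
    have := sq_le_sq' (abs_le.1 hs).1 (abs_le.1 hs).2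
    rw [e, Complex.norm_real, Real.norm_eq_abs, abs_of_nonneg (by linarith)]
    linarith [sq_nonneg s]
  have hqb : ∀ s : ℝ, |s| ≤ δ → ‖q s‖ ≤ δ := fun s hs => by simpa [hq] using hs
  have hδj : 0 ≤ δ ^ j := by positivity
  have hGb : ∀ s : ℝ, |s| ≤ δ → ‖G s‖ ≤ δ ^ j := fun s hs => by
    rw [hG, norm_mul, norm_pow, norm_pow]
    calc ‖w s‖ ^ 2 * ‖q s‖ ^ j ≤ 1 ^ 2 * δ ^ j := by
          gcongr
          · exact (hwb s hs).trans (pow_le_one₀ hδ0.le hδ1)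
          · exact hqb s hs
      _ = δ ^ j := by ring
  have hG''b : ∀ s : ℝ, |s| ≤ δ → ‖G'' s‖ ≤ 12 * ((j : ℝ) + 1) ^ 2 * δ ^ j := fun s hs => by
    have hw1 := hwb s hs
    have hq1 := hqb s hs
    have hδ2 : δ ^ 2 ≤ 1 := pow_le_one₀ hδ0.le hδ1
    have e1 : ‖(8 * (s : ℂ) ^ 2 - 4 * w s) * q s ^ j‖ ≤ 12 * δ ^ j := by
      rw [norm_mul, norm_pow]
      have : ‖8 * (s : ℂ) ^ 2 - 4 * w s‖ ≤ 12 := by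
        refine (norm_sub_le _ _).trans ?_
        have : ‖(s : ℂ)‖ ^ 2 ≤ 1 := by
          rw [Complex.norm_real, Real.norm_eq_abs]
          exact pow_le_one₀ (abs_nonneg s) (hs.trans hδ1)
        simp only [norm_mul, norm_pow, Complex.norm_ofNat]
        linarith
      gcongr
    -- Each derivative of `q ^ j` loses a factor `δ`; it is regained here from `|s| ≤ δ` and, twice,
    -- in `e3` from `‖w s‖ ^ 2 ≤ δ ^ 2`.
    have e2 : ‖2 * (2 * w s * (-2 * s)) * (j * q s ^ (j - 1) * Complex.I)‖ ≤ 8 * (j * δ ^ j) := by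
      have h3 : ‖2 * (2 * w s * (-2 * (s : ℂ)))‖ ≤ 8 * δ := by
        simp only [norm_mul, Complex.norm_ofNat, norm_neg, Complex.norm_real, Real.norm_eq_abs]
        nlinarith [abs_nonneg s, norm_nonneg (w s)]
      have h4 := norm_natCast_mul_pow_sub_one_mul_le hq1 j
      rw [norm_mul, norm_mul _ Complex.I, Complex.norm_I, mul_one]
      calc _ ≤ 8 * δ * ‖(j : ℂ) * q s ^ (j - 1)‖ := by gcongr
        _ = 8 * (‖(j : ℂ) * q s ^ (j - 1)‖ * δ) := by ring
        _ ≤ _ := by gcongr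
    have e3 : ‖w s ^ 2 * (j * ((j - 1 : ℕ) * q s ^ (j - 1 - 1) * Complex.I) * Complex.I)‖ ≤
        (j : ℝ) ^ 2 * δ ^ j := by
      have h4 := norm_natCast_mul_pow_sub_one_mul_le hq1 (j - 1)
      have h5 : (j : ℝ) * (((j - 1 : ℕ) : ℝ) * δ ^ (j - 1)) * δ ≤ (j : ℝ) ^ 2 * δ ^ j := by
        rcases j with _ | j
        · simp
        · rw [Nat.add_sub_cancel]
          push_cast
          rw [pow_succ δ]
          have : 0 ≤ δ ^ j * δ := by positivity
          nlinarith [mul_nonneg this (Nat.cast_nonneg (α := ℝ) j)]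
      have h6 : ‖w s‖ ^ 2 ≤ δ ^ 2 := by
        calc ‖w s‖ ^ 2 ≤ (δ ^ 2) ^ 2 := by gcongr
          _ = δ ^ 2 * δ ^ 2 := by ring
          _ ≤ δ ^ 2 * 1 := by gcongr
          _ = _ := mul_one _
      set X := ‖((j - 1 : ℕ) : ℂ) * q s ^ (j - 1 - 1)‖ with hX
      have h7 : ‖w s ^ 2 * (j * ((j - 1 : ℕ) * q s ^ (j - 1 - 1) * Complex.I) * Complex.I)‖ =
          ‖w s‖ ^ 2 * (j * X) := by
        rw [norm_mul, norm_mul _ Complex.I, norm_mul (j : ℂ), norm_mul _ Complex.I]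
        simp [hX]
      have hX0 : 0 ≤ X := norm_nonneg _
      rw [h7]
      calc ‖w s‖ ^ 2 * (j * X) ≤ δ ^ 2 * (j * X) := by gcongr
        _ = (j : ℝ) * (X * δ) * δ := by ring
        _ ≤ (j : ℝ) * (((j - 1 : ℕ) : ℝ) * δ ^ (j - 1)) * δ := by gcongr
        _ ≤ _ := h5
    refine (norm_add₃_le.trans (add_le_add (add_le_add e1 e2) e3)).trans ?_
    nlinarith [mul_nonneg hδj (Nat.cast_nonneg (α := ℝ) j), mul_nonneg hδj (sq_nonneg (j : ℝ))]
  have hparts := integral_mul_exp_eq_of_hasDerivAt (a := -δ) (b := δ) h1 h2 hc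
    (by simp [hG, hwδ]) (by simp [hG, hwδ]) (by simp [hG', hwδ]) (by simp [hG', hwδ]) t
  set N : ℂ := ∫ s in (-δ)..δ, G s * Complex.exp (Complex.I * s * t) with hN
  have hlen : |δ - -δ| ≤ 2 := by rw [abs_of_nonneg] <;> linarith
  have n1 : ‖N‖ ≤ δ ^ j * 2 := by
    refine (intervalIntegral.norm_integral_le_of_norm_le_const (C := δ ^ j) fun s h => ?_).trans
      (by gcongr)
    rw [norm_mul, hexp, mul_one]
    exact hGb s (hs s h)
  have n2 : t ^ 2 * ‖N‖ ≤ 12 * ((j : ℝ) + 1) ^ 2 * δ ^ j * 2 := by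
    have : t ^ 2 * ‖N‖ = ‖(t : ℂ) ^ 2 * N‖ := by
      rw [norm_mul, norm_pow, Complex.norm_real, Real.norm_eq_abs, sq_abs]
    rw [this, hparts, norm_neg]
    refine (intervalIntegral.norm_integral_le_of_norm_le_const fun s h => ?_).trans
      (mul_le_mul_of_nonneg_left hlen (by positivity))
    rw [norm_mul, hexp, mul_one]
    exact hG''b s (hs s h)
  have hMN : ‖oscMoment z₀ δ j t‖ = ‖N‖ := by
    have : oscMoment z₀ δ j t = Complex.exp (z₀ * t) * N := by
      rw [hN, ← intervalIntegral.integral_const_mul, oscMoment]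
      refine intervalIntegral.integral_congr fun s _ => ?_
      simp only [momentWeight, hG, hw, hq, add_mul, Complex.exp_add]
      ring
    rw [this, norm_mul, norm_exp_mul_ofReal_of_re_eq_zero hz, one_mul]
  rw [hMN, le_div_iff₀ (by positivity)]
  nlinarith [mul_nonneg hδj (Nat.cast_nonneg (α := ℝ) j), mul_nonneg hδj (sq_nonneg (j : ℝ))]

/-! ### Series of functions dominated in every seminorm -/

namespace WithSeminorms

variable {E : Type*} [AddCommGroup E] [Module ℂ E] [UniformSpace E] [IsUniformAddGroup E]
  [CompleteSpace E] [T2Space E] {p : ℕ → Seminorm ℂ E} {β : Type*} {g : β → ℝ → E} {U : Set ℝ}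
  {M : ℕ → β → ℝ}

theorem summable_of_dominated (hp : WithSeminorms p) (hM : ∀ k, Summable (M k))
    (hb : ∀ k b, ∀ t ∈ U, p k (g b t) ≤ M k b) {t : ℝ} (ht : t ∈ U) : Summable fun b => g b t :=
  hp.summable_of_seminorm fun k =>
    Summable.of_nonneg_of_le (fun _ => apply_nonneg _ _) (fun b => hb k b t ht) (hM k)

theorem continuousOn_tsum_of_dominated (hp : WithSeminorms p) (hg : ∀ b, ContinuousOn (g b) U)
    (hM : ∀ k, Summable (M k)) (hb : ∀ k b, ∀ t ∈ U, p k (g b t) ≤ M k b) :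
    ContinuousOn (fun t => ∑' b, g b t) U := by
  intro t₀ ht₀
  rw [ContinuousWithinAt, hp.tendsto_nhds]
  intro k ε hε
  have hle : ∀ b, ∀ t ∈ U, p k (g b t - g b t₀) ≤ 2 * M k b := fun b t ht =>
    (map_sub_le_add _ _ _).trans (by linarith [hb k b t ht, hb k b t₀ ht₀])
  have h1 : Tendsto (fun t => ∑' b, p k (g b t - g b t₀)) (𝓝[U] t₀) (𝓝 (∑' _ : β, (0 : ℝ))) := by
    refine tendsto_tsum_of_dominated_convergence (bound := fun b => 2 * M k b)
      ((hM k).mul_left 2) (fun b => ?_) ?_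
    · have h2 : Tendsto (fun t => g b t - g b t₀) (𝓝[U] t₀) (𝓝 0) :=
        tendsto_sub_nhds_zero_iff.2 (hg b t₀ ht₀)
      simpa [Function.comp_def] using ((hp.continuous_seminorm k).tendsto 0).comp h2
    · filter_upwards [self_mem_nhdsWithin] with t ht b
      rw [Real.norm_of_nonneg (apply_nonneg _ _)]
      exact hle b t ht
  rw [tsum_zero] at h1
  filter_upwards [h1.eventually_lt_const hε, self_mem_nhdsWithin] with t ht1 ht
  have s1 := hp.summable_of_dominated hM hb ht
  have s2 := hp.summable_of_dominated hM hb ht₀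
  rw [← s1.tsum_sub s2]
  exact (hp.seminorm_tsum_le (s1.sub s2) (Summable.of_nonneg_of_le (fun _ => apply_nonneg _ _)
    (fun b => hle b t ht) ((hM k).mul_left 2))).trans_lt ht1

/-- A functional is dominated by a multiple of a single `p k`, so scalar dominated convergence
suffices. -/
theorem hasVectorIntegral_tsum [Countable β] [ContinuousSMul ℂ E] (hp : WithSeminorms p)
    (hmono : Monotone p) {a c : ℝ} (hg : ∀ b, ContinuousOn (g b) (uIcc a c))
    (hM : ∀ k, Summable (M k)) (hb : ∀ k b, ∀ t ∈ uIcc a c, p k (g b t) ≤ M k b) {y : β → E}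
    (hy : ∀ b, HasVectorIntegral (g b) a c (y b)) :
    Summable y ∧ HasVectorIntegral (fun t => ∑' b, g b t) a c (∑' b, y b) := by
  have := hp.toPolynormableSpace
  have hsum : Summable y := hp.summable_of_seminorm fun k =>
    Summable.of_nonneg_of_le (fun _ => apply_nonneg _ _)
      (fun b => (hy b).seminorm_le (hp.continuous_seminorm k) (hb k b)) ((hM k).mul_right _)
  refine ⟨hsum, fun φ => ?_⟩
  have hcont := hp.continuousOn_tsum_of_dominated hg hM hb
  refine ⟨(φ.continuous.comp_continuousOn hcont).intervalIntegrable, ?_⟩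
  obtain ⟨k, N, hN, hφ⟩ := hp.exists_le_of_monotone hmono
    ((normSeminorm ℂ ℂ).comp φ.toLinearMap) φ.continuous.norm
  have hφ' : ∀ x, ‖φ x‖ ≤ N * p k x := hφ
  have h1 : HasSum (fun b => ∫ t in a..c, φ (g b t)) (∫ t in a..c, φ (∑' b, g b t)) := by
    refine intervalIntegral.hasSum_integral_of_dominated_convergence
      (fun b _ => N * M k b) (fun b => ?_) (fun b => Eventually.of_forall fun t ht => ?_)
      (Eventually.of_forall fun t _ => (hM k).mul_left N) intervalIntegrable_const
      (Eventually.of_forall fun t ht => ?_)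
    · exact ((φ.continuous.comp_continuousOn (hg b)).mono
        uIoc_subset_uIcc).aestronglyMeasurable measurableSet_uIoc
    · exact (hφ' _).trans (by gcongr; exact hb k b t (uIoc_subset_uIcc ht))
    · exact (hp.summable_of_dominated hM hb (uIoc_subset_uIcc ht)).hasSum.mapL φ
  have h2 := hsum.hasSum.mapL φ
  simp only [(hy _ φ).2] at h2
  exact h2.unique h1

end WithSeminorms

/-! ### Power series of eigenvectors -/

section PowerSeries

variable {E : Type*} [AddCommGroup E] [Module ℂ E] [TopologicalSpace E] {z₀ : ℂ} {r : ℝ}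

theorem coeff_eq_zero_of_hasSum_zero (hr : 0 < r) {c : ℕ → ℂ}
    (h : ∀ w ∈ Metric.ball z₀ r, HasSum (fun n => (w - z₀) ^ n • c n) 0) (n : ℕ) : c n = 0 := by
  have h1 : HasFPowerSeriesAt (0 : ℂ → ℂ) (FormalMultilinearSeries.ofScalars ℂ c) z₀ := by
    rw [hasFPowerSeriesAt_iff']
    filter_upwards [Metric.ball_mem_nhds z₀ hr] with w hw
    simpa [FormalMultilinearSeries.coeff_ofScalars] using h w hw
  have h2 := congrArg (fun q => FormalMultilinearSeries.coeff q n) h1.eq_zero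
  simp only [FormalMultilinearSeries.coeff_ofScalars] at h2
  exact h2.trans rfl

theorem analyticAt_of_hasSum (hr : 0 < r) {g : ℂ → ℂ} {c : ℕ → ℂ}
    (h : ∀ w ∈ Metric.ball z₀ r, HasSum (fun n => (w - z₀) ^ n • c n) (g w)) :
    AnalyticAt ℂ g z₀ := by
  refine ⟨FormalMultilinearSeries.ofScalars ℂ c, ?_⟩
  rw [hasFPowerSeriesAt_iff']
  filter_upwards [Metric.ball_mem_nhds z₀ hr] with w hw
  simpa [FormalMultilinearSeries.coeff_ofScalars] using h w hw

theorem IsAnalyticMapOn.analyticOnNhd_comp {f : ℂ → E} {Ω : Set ℂ} (hf : IsAnalyticMapOn f Ω)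
    (φ : E →L[ℂ] ℂ) : AnalyticOnNhd ℂ (fun z => φ (f z)) Ω := fun z hz => by
  obtain ⟨a, r, hr, h⟩ := hf z hz
  refine analyticAt_of_hasSum hr (c := fun n => φ (a n)) fun w hw => ?_
  simpa using (h w hw).mapL φ

/-- A functional annihilating `F` turns the series into a scalar power series with sum zero, so it
kills each coefficient. This is used both for the closed span of `f` and for the graph of `A`. -/
theorem coeff_mem_of_hasSum_mem [IsTopologicalAddGroup E] [ContinuousSMul ℂ E]
    [LocallyConvexSpace ℝ E] (hr : 0 < r) {g : ℂ → E} {c : ℕ → E}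
    (h : ∀ w ∈ Metric.ball z₀ r, HasSum (fun n => (w - z₀) ^ n • c n) (g w)) {F : Submodule ℂ E}
    (hF : IsClosed (F : Set E)) (hg : ∀ w ∈ Metric.ball z₀ r, g w ∈ F) (n : ℕ) : c n ∈ F := by
  refine Submodule.mem_of_forall_dual_eq_zero hF fun φ hφ => ?_
  refine coeff_eq_zero_of_hasSum_zero (z₀ := z₀) hr (c := fun n => φ (c n)) (fun w hw => ?_) n
  have h1 := (h w hw).mapL φ
  rw [hφ _ (hg w hw)] at h1
  simpa using h1

theorem exists_coeff_bound {ρ : ℝ} (hρ : 0 < ρ) (hρr : ρ < r) {g : ℂ → E} {c : ℕ → E}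
    [IsTopologicalAddGroup E]
    (h : ∀ w ∈ Metric.ball z₀ r, HasSum (fun n => (w - z₀) ^ n • c n) (g w)) {q : Seminorm ℂ E}
    (hq : Continuous q) : ∃ M : ℝ, ∀ n, q (c n) ≤ M * ρ⁻¹ ^ n := by
  have h1 := (h (z₀ + ρ) (by simpa [abs_of_pos hρ] using hρr)).summable.tendsto_atTop_zero
  have h2 := ((hq.tendsto 0).comp h1).bddAbove_range
  obtain ⟨M, hM⟩ := h2
  refine ⟨M, fun n => ?_⟩
  have h3 : q ((z₀ + ρ - z₀) ^ n • c n) ≤ M := hM ⟨n, rfl⟩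
  rw [add_sub_cancel_left, map_smul_eq_mul, norm_pow, Complex.norm_real, Real.norm_eq_abs,
    abs_of_pos hρ] at h3
  rw [inv_pow, ← div_eq_mul_inv, le_div_iff₀ (by positivity)]
  linarith

/-- The sequence `0, a 0, a 1, …`. -/
def shiftSeq (a : ℕ → E) : ℕ → E
  | 0 => 0
  | n + 1 => a n

theorem hasSum_shiftSeq {a : ℕ → E} {c : ℕ → ℂ} {x : E} [IsTopologicalAddGroup E]
    (h : HasSum (fun n => c (n + 1) • a n) x) : HasSum (fun n => c n • shiftSeq a n) x := by
  have := (hasSum_nat_add_iff (f := fun n => c n • shiftSeq a n) (g := x) 1).1 h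
  simpa [shiftSeq] using this

/-- Writing `w = z₀ + (w - z₀)`, these pairs are the coefficients of the graph-valued power series
of `(f w, w • f w)`. -/
theorem coeff_mem_graph [IsTopologicalAddGroup E] [ContinuousSMul ℂ E] [LocallyConvexSpace ℝ E]
    {A : E →ₗ.[ℂ] E} (hA : A.IsClosed) (hr : 0 < r) {f : ℂ → E} {a : ℕ → E}
    (h : ∀ w ∈ Metric.ball z₀ r, HasSum (fun n => (w - z₀) ^ n • a n) (f w))
    (hf : ∀ w ∈ Metric.ball z₀ r, (f w, w • f w) ∈ A.graph) (n : ℕ) :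
    (a n, z₀ • a n + shiftSeq a n) ∈ A.graph := by
  refine coeff_mem_of_hasSum_mem (z₀ := z₀) hr (g := fun w => (f w, w • f w))
    (c := fun n => (a n, z₀ • a n + shiftSeq a n)) (fun w hw => ?_) hA hf n
  have h1 := (h w hw).const_smul z₀
  have h2 : HasSum (fun n => (w - z₀) ^ n • shiftSeq a n) ((w - z₀) • f w) := by
    refine hasSum_shiftSeq (c := fun n => (w - z₀) ^ n) ?_
    simpa [pow_succ', mul_smul] using (h w hw).const_smul (w - z₀)
  have h3 := h1.add h2
  rw [← add_smul, add_sub_cancel] at h3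
  refine ((h w hw).prodMk h3).congr_fun fun n => ?_
  simp [smul_comm z₀]

end PowerSeries

/-! ### Rapidly decreasing complete orbits -/

section

variable {E : Type*} [AddCommGroup E] [Module ℂ E] [TopologicalSpace E]

/-- `u : ℝ → E` is a mild solution of `u' = A u` on the whole line. -/
structure IsCompleteOrbit (A : E →ₗ.[ℂ] E) (u : ℝ → E) : Prop where
  continuous : Continuous u
  integral : ∀ a b : ℝ, ∃ y : E, HasVectorIntegral u a b y ∧ (y, u b - u a) ∈ A.graph

/-- A complete orbit in `F` which is `O(1 / (1 + t²))` in each of the seminorms `p k`. -/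
structure IsRapidOrbit (p : ℕ → Seminorm ℂ E) (A : E →ₗ.[ℂ] E) (F : Submodule ℂ E)
    (u : ℝ → E) : Prop extends IsCompleteOrbit A u where
  mem : ∀ t, u t ∈ F
  decay : ∀ k, ∃ M : ℝ, ∀ t, p k (u t) ≤ M / (1 + t ^ 2)

namespace IsCompleteOrbit

variable {A : E →ₗ.[ℂ] E} {u : ℝ → E}

theorem comp_add_right (hu : IsCompleteOrbit A u) (d : ℝ) :
    IsCompleteOrbit A fun t => u (t + d) where
  continuous := hu.continuous.comp (by fun_prop)
  integral a b := by
    obtain ⟨y, hy, hg⟩ := hu.integral (a + d) (b + d)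
    exact ⟨y, hy.comp_add_right d, hg⟩

theorem isMildSolution (hu : IsCompleteOrbit A u) : IsMildSolution A (u 0) u :=
  ⟨hu.continuous.continuousOn, fun t _ => hu.integral 0 t⟩

end IsCompleteOrbit

/-- The values at `0` of the rapidly decreasing complete orbits in `F`. -/
def rapidOrbitSubmodule [IsTopologicalAddGroup E] [ContinuousSMul ℂ E] (p : ℕ → Seminorm ℂ E)
    (A : E →ₗ.[ℂ] E) (F : Submodule ℂ E) : Submodule ℂ E where
  carrier := {x | ∃ u, IsRapidOrbit p A F u ∧ u 0 = x}
  zero_mem' := ⟨0, { continuous := continuous_const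
                     integral := fun a b => ⟨0, fun φ => by simp, by simp⟩
                     mem := fun _ => F.zero_mem
                     decay := fun k => ⟨0, fun t => by simp⟩ }, rfl⟩
  add_mem' := by
    rintro _ _ ⟨u, hu, rfl⟩ ⟨v, hv, rfl⟩
    refine ⟨u + v, { continuous := hu.continuous.add hv.continuous
                     integral := fun a b => ?_
                     mem := fun t => F.add_mem (hu.mem t) (hv.mem t)
                     decay := fun k => ?_ }, rfl⟩
    · obtain ⟨y, hy, hyg⟩ := hu.integral a b
      obtain ⟨z, hz, hzg⟩ := hv.integral a b
      refine ⟨y + z, hy.add hz, ?_⟩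
      have := A.graph.add_mem hyg hzg
      rwa [Prod.mk_add_mk, sub_add_sub_comm] at this
    · obtain ⟨M, hM⟩ := hu.decay k
      obtain ⟨N, hN⟩ := hv.decay k
      refine ⟨M + N, fun t => (map_add_le_add _ _ _).trans ?_⟩
      rw [add_div]
      exact add_le_add (hM t) (hN t)
  smul_mem' := by
    rintro c _ ⟨u, hu, rfl⟩
    refine ⟨c • u, { continuous := hu.continuous.const_smul c
                     integral := fun a b => ?_
                     mem := fun t => F.smul_mem c (hu.mem t)
                     decay := fun k => ?_ }, rfl⟩
    · obtain ⟨y, hy, hyg⟩ := hu.integral a b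
      refine ⟨c • y, hy.smul c, ?_⟩
      have := A.graph.smul_mem c hyg
      rwa [Prod.smul_mk, smul_sub] at this
    · obtain ⟨M, hM⟩ := hu.decay k
      refine ⟨‖c‖ * M, fun t => ?_⟩
      rw [Pi.smul_apply, map_smul_eq_mul, mul_div_assoc]
      gcongr
      exact hM t

end

section

variable {E : Type*} [AddCommGroup E] [Module ℂ E] [UniformSpace E] [IsUniformAddGroup E]
  [ContinuousSMul ℂ E] [CompleteSpace E] [T2Space E] [LocallyConvexSpace ℝ E]
  {p : ℕ → Seminorm ℂ E} {A : E →ₗ.[ℂ] E} {z₀ : ℂ} {r δ : ℝ} {f : ℂ → E} {a : ℕ → E}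

theorem summable_moment_bound {q : ℕ → ℝ} {M ρ : ℝ} (hδ : 0 < δ) (hδρ : δ < ρ)
    (hq0 : ∀ n, 0 ≤ q n) (hq : ∀ n, q n ≤ M * ρ⁻¹ ^ n) (k : ℕ) :
    Summable fun n => 30 * (((n + k : ℕ) : ℝ) + 1) ^ 2 * δ ^ (n + k) * q n := by
  have hρ : 0 < ρ := hδ.trans hδρ
  have hx : δ * ρ⁻¹ < 1 := by rwa [← div_eq_mul_inv, div_lt_one hρ]
  have hx0 : 0 < δ * ρ⁻¹ := by positivity
  have h1 := summable_pow_mul_geometric_of_norm_lt_one 2 (r := δ * ρ⁻¹)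
    (by rwa [Real.norm_of_nonneg hx0.le])
  -- The shift by `k + 1` produces the polynomial factor `(n + k + 1)²`; the surplus powers of `δ *
  -- ρ⁻¹` are divided out in the constant.
  have h2 := ((summable_nat_add_iff (k + 1)).2 h1).mul_left
    (30 * δ ^ k * M * ((δ * ρ⁻¹) ^ (k + 1))⁻¹)
  refine Summable.of_nonneg_of_le (fun n => by have := hq0 n; positivity) (fun n => ?_) h2
  calc 30 * (((n + k : ℕ) : ℝ) + 1) ^ 2 * δ ^ (n + k) * q n
      ≤ 30 * (((n + k : ℕ) : ℝ) + 1) ^ 2 * δ ^ (n + k) * (M * ρ⁻¹ ^ n) := by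
        gcongr
        exact hq n
    _ = _ := by
        rw [pow_add (δ * ρ⁻¹) n (k + 1), mul_pow δ ρ⁻¹ n]
        push_cast
        field_simp
        ring

/-- The orbit `∫_{-δ}^{δ} (δ² - s²)² (i s)^k e^{(z₀ + i s) t} f(z₀ + i s) ds` for
`f(z) = ∑ (z - z₀)^n a_n`. -/
noncomputable def momentOrbit (z₀ : ℂ) (δ : ℝ) (a : ℕ → E) (k : ℕ) (t : ℝ) : E :=
  ∑' n, oscMoment z₀ δ (n + k) t • a n

theorem exists_momentOrbit_bound (hz : z₀.re = 0) (hδ0 : 0 < δ) (hδ1 : δ ≤ 1) (hδr : δ < r)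
    (h : ∀ w ∈ Metric.ball z₀ r, HasSum (fun n => (w - z₀) ^ n • a n) (f w)) {q : Seminorm ℂ E}
    (hq : Continuous q) (k : ℕ) : ∃ M : ℕ → ℝ, Summable M ∧
      ∀ n t, q (oscMoment z₀ δ (n + k) t • a n) ≤ M n / (1 + t ^ 2) := by
  obtain ⟨ρ, hδρ, hρr⟩ := exists_between hδr
  obtain ⟨B, hB⟩ := exists_coeff_bound (hδ0.trans hδρ) hρr h hq
  refine ⟨_, summable_moment_bound hδ0 hδρ (fun n => apply_nonneg q (a n)) hB k, fun n t => ?_⟩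
  rw [map_smul_eq_mul, mul_div_right_comm]
  gcongr
  exact norm_oscMoment_le hz hδ0 hδ1 (n + k) t

theorem hasSum_momentOrbit (hp : WithSeminorms p) (hz : z₀.re = 0) (hδ0 : 0 < δ) (hδ1 : δ ≤ 1)
    (hδr : δ < r) (h : ∀ w ∈ Metric.ball z₀ r, HasSum (fun n => (w - z₀) ^ n • a n) (f w))
    (k : ℕ) (t : ℝ) : HasSum (fun n => oscMoment z₀ δ (n + k) t • a n) (momentOrbit z₀ δ a k t) := by
  refine (hp.summable_of_seminorm fun i => ?_).hasSum
  obtain ⟨M, hM, hb⟩ := exists_momentOrbit_bound hz hδ0 hδ1 hδr h (hp.continuous_seminorm i) k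
  exact Summable.of_nonneg_of_le (fun _ => apply_nonneg _ _) (fun n => hb n t) (hM.div_const _)

/-- The orbit is integrated term by term. Applying `A` to the integrated series shifts coefficients,
reindexing turns this into a shift of moments, and `integral_oscMoment` identifies the result as the
increment of the orbit. Decay is inherited from the moments. -/
theorem isRapidOrbit_momentOrbit (hp : WithSeminorms p) (hmono : Monotone p) (hA : A.IsClosed)
    (hz : z₀.re = 0) (hδ0 : 0 < δ) (hδ1 : δ ≤ 1) (hδr : δ < r)
    (h : ∀ w ∈ Metric.ball z₀ r, HasSum (fun n => (w - z₀) ^ n • a n) (f w))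
    (hf : ∀ w ∈ Metric.ball z₀ r, (f w, w • f w) ∈ A.graph) {F : Submodule ℂ E}
    (hF : IsClosed (F : Set E)) (hfF : ∀ w ∈ Metric.ball z₀ r, f w ∈ F) (k : ℕ) :
    IsRapidOrbit p A F (momentOrbit z₀ δ a k) := by
  have := hp.toPolynormableSpace
  have hr : 0 < r := hδ0.trans hδr
  choose M hM hdec using fun k i =>
    exists_momentOrbit_bound hz hδ0 hδ1 hδr h (hp.continuous_seminorm i) k
  have hM0 : ∀ k i n, 0 ≤ M k i n := fun k i n => by
    simpa using (apply_nonneg _ _).trans (hdec k i n 0)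
  have hb : ∀ k i n, ∀ t ∈ (univ : Set ℝ), p i (oscMoment z₀ δ (n + k) t • a n) ≤ M k i n :=
    fun k i n t _ => (hdec k i n t).trans
      (div_le_self (hM0 k i n) (by nlinarith [sq_nonneg t]))
  have hc : ∀ k n, Continuous fun t => oscMoment z₀ δ (n + k) t • a n := fun k n =>
    (continuous_oscMoment hz δ (n + k)).smul continuous_const
  have hsum := hasSum_momentOrbit hp hz hδ0 hδ1 hδr h
  have haF : ∀ n, a n ∈ F := coeff_mem_of_hasSum_mem hr h hF hfF
  refine { continuous := ?_, integral := fun b c => ?_, mem := fun t => ?_, decay := fun i => ?_ }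
  · rw [← continuousOn_univ]
    exact hp.continuousOn_tsum_of_dominated (fun n => (hc k n).continuousOn) (hM k) (hb k)
  · -- `I j n` is the integral of the `n`-th term of `momentOrbit z₀ δ a j`
    set I : ℕ → ℂ := fun j => ∫ t in b..c, oscMoment z₀ δ j t with hI
    have hint : ∀ j, Summable (fun n => I (n + j) • a n) ∧
        HasVectorIntegral (momentOrbit z₀ δ a j) b c (∑' n, I (n + j) • a n) := fun j =>
      hp.hasVectorIntegral_tsum hmono (fun n => (hc j n).continuousOn) (hM j)
        (fun i n t _ => hb j i n t (mem_univ t)) fun n =>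
          HasVectorIntegral.const_smul_of_scalar
            ((continuous_oscMoment hz δ (n + j)).intervalIntegrable _ _) (a n)
    refine ⟨_, (hint k).2, ?_⟩
    have h1 : HasSum (fun n => I (n + k) • shiftSeq a n) (∑' n, I (n + (k + 1)) • a n) := by
      refine hasSum_shiftSeq (c := fun n => I (n + k)) ?_
      simpa only [add_right_comm, ← add_assoc] using (hint (k + 1)).1.hasSum
    have h2 : HasSum (fun n => I (n + k) • (z₀ • a n + shiftSeq a n))
        (z₀ • (∑' n, I (n + k) • a n) + ∑' n, I (n + (k + 1)) • a n) := by
      refine (((hint k).1.hasSum.const_smul z₀).add h1).congr_fun fun n => ?_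
      rw [smul_add, smul_comm]
    have h3 : z₀ • (∑' n, I (n + k) • a n) + ∑' n, I (n + (k + 1)) • a n =
        momentOrbit z₀ δ a k c - momentOrbit z₀ δ a k b := by
      refine (((hint k).1.hasSum.const_smul z₀).add (hint (k + 1)).1.hasSum).unique ?_
      refine ((hsum k c).sub (hsum k b)).congr_fun fun n => ?_
      rw [smul_smul, ← add_smul, ← sub_smul, ← integral_oscMoment hz, add_assoc n k 1]
    rw [h3] at h2
    refine IsClosed.mem_of_tendsto hA ((hint k).1.hasSum.prodMk h2) (Eventually.of_forall fun s => ?_)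
    refine A.graph.sum_mem fun n _ => ?_
    exact A.graph.smul_mem (I (n + k)) (coeff_mem_graph hA hr h hf n)
  · exact hF.mem_of_tendsto (hsum k t) (Eventually.of_forall fun s =>
      F.sum_mem fun n _ => F.smul_mem _ (haF n))
  · refine ⟨∑' n, M k i n, fun t => ?_⟩
    rw [← tsum_div_const]
    exact (hp.seminorm_tsum_le (hsum k t).summable (Summable.of_nonneg_of_le (fun _ => apply_nonneg _ _)
      (fun n => hdec k i n t) ((hM k i).div_const _))).trans
      (Summable.tsum_le_tsum (fun n => hdec k i n t) (Summable.of_nonneg_of_le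
        (fun _ => apply_nonneg _ _) (fun n => hdec k i n t) ((hM k i).div_const _))
        ((hM k i).div_const _))

end

/-! ### Density of the rapidly decreasing orbits -/

theorem hasSum_integral_mul_powerSeries {δ : ℝ} (hδ : 0 < δ) {b : ℕ → ℂ} {h ω : ℝ → ℂ}
    (hb : Summable fun n => δ ^ n * ‖b n‖)
    (hh : ∀ s ∈ Icc (-δ) δ, HasSum (fun n => (Complex.I * s) ^ n * b n) (h s))
    (hω : ContinuousOn ω (Icc (-δ) δ)) :
    HasSum (fun n => (∫ s in (-δ)..δ, ω s * (Complex.I * s) ^ n) * b n)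
      (∫ s in (-δ)..δ, ω s * h s) := by
  have hle : -δ ≤ δ := by linarith
  have hsub : ∀ s ∈ uIoc (-δ) δ, s ∈ Icc (-δ) δ := fun s hs => by
    rw [uIoc_of_le hle] at hs
    exact Ioc_subset_Icc_self hs
  have key : HasSum (fun n => ∫ s in (-δ)..δ, ω s * ((Complex.I * s) ^ n * b n))
      (∫ s in (-δ)..δ, ω s * h s) := by
    refine intervalIntegral.hasSum_integral_of_dominated_convergence
      (fun n s => ‖ω s‖ * (δ ^ n * ‖b n‖)) (fun n => ?_) (fun n => Eventually.of_forall fun s hs => ?_)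
      (Eventually.of_forall fun s _ => hb.mul_left _) ?_
      (Eventually.of_forall fun s hs => (hh s (hsub s hs)).mul_left (ω s))
    · have hc : ContinuousOn (fun s : ℝ => ω s * ((Complex.I * s) ^ n * b n)) (Icc (-δ) δ) :=
        hω.mul (Continuous.continuousOn (by fun_prop))
      exact (hc.mono hsub).aestronglyMeasurable measurableSet_uIoc
    · have := abs_le.2 (hsub s hs)
      rw [norm_mul, norm_mul, norm_pow]
      have h1 : ‖Complex.I * (s : ℂ)‖ = |s| := by simp
      rw [h1]
      gcongr
    · simp only [tsum_mul_left]
      refine ContinuousOn.intervalIntegrable ?_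
      rw [uIcc_of_le hle]
      exact hω.norm.mul continuousOn_const
  refine key.congr_fun fun n => ?_
  rw [← intervalIntegral.integral_mul_const]
  simp only [mul_assoc]

theorem momentWeight_add (δ : ℝ) (n k : ℕ) (s : ℝ) :
    momentWeight δ (n + k) s = momentWeight δ k s * (Complex.I * s) ^ n := by
  simp only [momentWeight, pow_add]
  ring

/-- Conjugation only changes the sign of `(is)^n` by `(-1)^n`, so the weighted conjugate of `h` also
integrates to zero against all powers. Integrating it against the power series of `h` itself leaves
the weighted integral of `|h|²`, which must vanish; no polynomial approximation is required. -/
theorem eq_zero_of_moments_eq_zero {δ : ℝ} (hδ : 0 < δ) {b : ℕ → ℂ} {h : ℝ → ℂ}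
    (hb : Summable fun n => δ ^ n * ‖b n‖)
    (hh : ∀ s ∈ Icc (-δ) δ, HasSum (fun n => (Complex.I * s) ^ n * b n) (h s))
    (hc : ContinuousOn h (Icc (-δ) δ))
    (h0 : ∀ k, ∑' n, (∫ s in (-δ)..δ, momentWeight δ (n + k) s) * b n = 0) :
    ∀ s ∈ Ioo (-δ) δ, h s = 0 := by
  have hle : -δ < δ := by linarith
  have h1 : ∀ k, ∫ s in (-δ)..δ, momentWeight δ k s * h s = 0 := fun k => by
    have := hasSum_integral_mul_powerSeries hδ hb hh (continuous_momentWeight δ k).continuousOn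
    rw [← this.tsum_eq, ← h0 k]
    simp only [momentWeight_add]
  set ω : ℝ → ℂ := fun s => momentWeight δ 0 s * (starRingEnd ℂ) (h s) with hω
  have hωc : ContinuousOn ω (Icc (-δ) δ) :=
    (continuous_momentWeight δ 0).continuousOn.mul (Complex.continuous_conj.comp_continuousOn hc)
  have h2 : ∀ n, ∫ s in (-δ)..δ, ω s * (Complex.I * s) ^ n = 0 := fun n => by
    have e : ∀ s : ℝ, ω s * (Complex.I * s) ^ n =
        (-1) ^ n * (starRingEnd ℂ) (momentWeight δ n s * h s) := fun s => by
      simp only [hω, momentWeight, map_mul, map_pow, map_sub, Complex.conj_ofReal, Complex.conj_I]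
      rw [neg_mul, neg_pow (Complex.I * (s : ℂ))]
      have : ((-1 : ℂ) ^ n) * (-1) ^ n = 1 := by rw [← mul_pow]; simp
      linear_combination (-((δ : ℂ) ^ 2 - s ^ 2) ^ 2 * (Complex.I * s) ^ n *
        (starRingEnd ℂ) (h s)) * this
    simp only [e]
    rw [intervalIntegral.integral_const_mul, intervalIntegral.intervalIntegral_conj, h1 n]
    simp
  have h3 : ∫ s in (-δ)..δ, ω s * h s = 0 := by
    have := hasSum_integral_mul_powerSeries hδ hb hh hωc
    simp only [h2, zero_mul] at this
    exact this.unique hasSum_zero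
  have h4 : ∫ s in (-δ)..δ, (δ ^ 2 - s ^ 2) ^ 2 * ‖h s‖ ^ 2 = 0 := by
    have e : ∀ s : ℝ, ω s * h s = (((δ ^ 2 - s ^ 2) ^ 2 * ‖h s‖ ^ 2 : ℝ) : ℂ) := fun s => by
      simp only [hω, momentWeight, pow_zero, mul_one, mul_assoc]
      rw [mul_comm _ (h s), Complex.mul_conj, Complex.normSq_eq_norm_sq]
      push_cast
      ring
    simp only [e] at h3
    rw [intervalIntegral.integral_ofReal] at h3
    exact_mod_cast h3
  intro s hs
  by_contra hne
  refine (intervalIntegral.integral_pos hle (f := fun s => (δ ^ 2 - s ^ 2) ^ 2 * ‖h s‖ ^ 2)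
    ?_ (fun s _ => by positivity) ⟨s, Ioo_subset_Icc_self hs, ?_⟩).ne' h4
  · exact (Continuous.continuousOn (by fun_prop)).mul (hc.norm.pow 2)
  · have : 0 < δ ^ 2 - s ^ 2 := by nlinarith [hs.1, hs.2]
    have := norm_pos_iff.2 hne
    positivity

theorem closure_span_le_closure_rapidOrbitSubmodule {E : Type*} [AddCommGroup E] [Module ℂ E]
    [UniformSpace E] [IsUniformAddGroup E] [ContinuousSMul ℂ E] [CompleteSpace E] [T2Space E]
    {p : ℕ → Seminorm ℂ E} (hp : WithSeminorms p) (hmono : Monotone p) {A : E →ₗ.[ℂ] E}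
    (hA : A.IsClosed) {Ω : Set ℂ} (hΩ_open : IsOpen Ω) (hΩ_conn : IsPreconnected Ω) {z₀ : ℂ}
    (hz₀ : z₀ ∈ Ω) (hre : z₀.re = 0) {f : ℂ → E} (hf : IsAnalyticMapOn f Ω)
    (hf_eig : ∀ z ∈ Ω, (f z, z • f z) ∈ A.graph) :
    (Submodule.span ℂ (f '' Ω)).topologicalClosure ≤
      (rapidOrbitSubmodule p A (Submodule.span ℂ (f '' Ω)).topologicalClosure).topologicalClosure := by
  have := hp.toLocallyConvexSpace
  set F := (Submodule.span ℂ (f '' Ω)).topologicalClosure with hFdef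
  have hF : IsClosed (F : Set E) := Submodule.isClosed_topologicalClosure _
  have hfF : ∀ z ∈ Ω, f z ∈ F := fun z hz =>
    Submodule.le_topologicalClosure _ (Submodule.subset_span ⟨z, hz, rfl⟩)
  refine Submodule.topologicalClosure_minimal _ ?_ (Submodule.isClosed_topologicalClosure _)
  rw [Submodule.span_le]
  rintro _ ⟨z, hz, rfl⟩
  refine Submodule.mem_of_forall_dual_eq_zero (Submodule.isClosed_topologicalClosure _)
    fun φ hφ => ?_
  obtain ⟨a, r₁, hr₁, h₁⟩ := hf z₀ hz₀
  obtain ⟨r₂, hr₂, h₂⟩ := Metric.isOpen_iff.1 hΩ_open z₀ hz₀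
  set r := min r₁ r₂ with hr
  have hr0 : 0 < r := lt_min hr₁ hr₂
  have hball : ∀ w ∈ Metric.ball z₀ r, HasSum (fun n => (w - z₀) ^ n • a n) (f w) := fun w hw =>
    h₁ w (Metric.ball_subset_ball (min_le_left _ _) hw)
  have hballΩ : ∀ w ∈ Metric.ball z₀ r, w ∈ Ω := fun w hw =>
    h₂ (Metric.ball_subset_ball (min_le_right _ _) hw)
  -- `δ < r` keeps the segment inside the disc of convergence, and `δ ≤ 1` is needed for
  -- `norm_oscMoment_le`.
  obtain ⟨δ, hδ0, hδ⟩ : ∃ δ, 0 < δ ∧ δ < min r 1 := exists_between (lt_min hr0 one_pos)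
  have hδr : δ < r := hδ.trans_le (min_le_left _ _)
  have hδ1 : δ ≤ 1 := (hδ.trans_le (min_le_right _ _)).le
  have horb : ∀ k, IsRapidOrbit p A F (momentOrbit z₀ δ a k) :=
    isRapidOrbit_momentOrbit hp hmono hA hre hδ0 hδ1 hδr hball
      (fun w hw => hf_eig w (hballΩ w hw)) hF fun w hw => hfF w (hballΩ w hw)
  have hmem : ∀ s ∈ Icc (-δ) δ, z₀ + Complex.I * (s : ℂ) ∈ Metric.ball z₀ r := fun s hs => by
    simpa using (abs_le.2 hs).trans_lt hδr
  have hφz : ∀ s ∈ Ioo (-δ) δ, φ (f (z₀ + Complex.I * (s : ℂ))) = 0 := by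
    refine eq_zero_of_moments_eq_zero hδ0 (b := fun n => φ (a n)) ?_ (fun s hs => ?_) ?_ fun k => ?_
    · have h3 := ((hball (z₀ + δ) (by simpa [abs_of_pos hδ0] using hδr)).mapL φ).summable.norm
      simpa [abs_of_pos hδ0] using h3
    · simpa using (hball _ (hmem s hs)).mapL φ
    · exact (hf.analyticOnNhd_comp φ).continuousOn.comp (Continuous.continuousOn (by fun_prop))
        fun s hs => hballΩ _ (hmem s hs)
    · have h3 := hφ (momentOrbit z₀ δ a k 0)
        (Submodule.le_topologicalClosure _ ⟨_, horb k, rfl⟩)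
      have h4 := (hasSum_momentOrbit hp hre hδ0 hδ1 hδr hball k 0).mapL φ
      rw [h3] at h4
      simpa [oscMoment] using h4.tsum_eq
  refine (hf.analyticOnNhd_comp φ).eqOn_zero_of_preconnected_of_frequently_eq_zero hΩ_conn hz₀ ?_ hz
  have ht : Tendsto (fun s : ℝ => z₀ + Complex.I * (s : ℂ)) (𝓝[≠] 0) (𝓝[≠] z₀) := by
    refine tendsto_nhdsWithin_iff.2 ⟨?_, ?_⟩
    · have : Continuous fun s : ℝ => z₀ + Complex.I * (s : ℂ) := by fun_prop
      simpa using (this.tendsto 0).mono_left nhdsWithin_le_nhds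
    · filter_upwards [self_mem_nhdsWithin] with s hs
      simpa using hs
  refine ht.frequently (Eventually.frequently ?_)
  filter_upwards [nhdsWithin_le_nhds (Ioo_mem_nhds (neg_lt_zero.2 hδ0) hδ0)] with s hs
  exact hφz s hs

/-! ### Construction of a frequently hypercyclic orbit -/

/-- The index `0` is admitted because `1 / 0 ^ 2 = 0`: later the differences from a given position
include the one from that position to itself. -/
theorem exists_inv_sq_tail_bound {ε : ℝ} (hε : 0 < ε) : ∃ K : ℕ, ∀ s : Finset ℤ,
    (∀ j ∈ s, j = 0 ∨ (K : ℤ) < |j|) → ∑ j ∈ s, 1 / (j : ℝ) ^ 2 ≤ ε := by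
  have hs : Summable fun j : ℤ => 1 / (j : ℝ) ^ 2 := Real.summable_one_div_int_pow.2 one_lt_two
  obtain ⟨s₀, h₀⟩ := summable_iff_vanishing_norm.1 hs ε hε
  refine ⟨s₀.sup Int.natAbs, fun s h => ?_⟩
  have h1 : ∑ j ∈ s \ s₀, 1 / (j : ℝ) ^ 2 = ∑ j ∈ s, 1 / (j : ℝ) ^ 2 := by
    refine Finset.sum_subset Finset.sdiff_subset fun j hj hj' => ?_
    have hj₀ : j ∈ s₀ := by
      by_contra hc
      exact hj' (Finset.mem_sdiff.2 ⟨hj, hc⟩)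
    have h2 : j.natAbs ≤ s₀.sup Int.natAbs := Finset.le_sup hj₀
    rcases h j hj with rfl | h3
    · simp
    · rw [Int.abs_eq_natAbs] at h3
      omega
  rw [← h1]
  exact (le_abs_self _).trans (h₀ _ Finset.sdiff_disjoint).le

theorem summable_inv_sq_and_tsum_le {K : ℕ} {ε : ℝ}
    (hK : ∀ s : Finset ℤ, (∀ j ∈ s, j = 0 ∨ (K : ℤ) < |j|) → ∑ j ∈ s, 1 / (j : ℝ) ^ 2 ≤ ε)
    {g : ℕ → ℤ} (hg : Function.Injective g) (h : ∀ i, g i = 0 ∨ (K : ℤ) < |g i|) :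
    Summable (fun i => 1 / (g i : ℝ) ^ 2) ∧ ∑' i, 1 / (g i : ℝ) ^ 2 ≤ ε := by
  have hs : Summable fun i => 1 / (g i : ℝ) ^ 2 :=
    (Real.summable_one_div_int_pow.2 one_lt_two).comp_injective hg
  refine ⟨hs, hs.tsum_le_of_sum_le fun s => ?_⟩
  have := hK (s.map ⟨g, hg⟩) fun j hj => by
    obtain ⟨i, -, rfl⟩ := Finset.mem_map.1 hj
    exact h i
  simpa using this

theorem summable_weighted_rows {w ρ : ℕ → ℝ} (hw : ∀ l, 0 ≤ w l) {g : ℕ × ℕ → ℝ} (hg0 : ∀ q, 0 ≤ g q)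
    (hg : ∀ l, Summable fun i => g (l, i)) (hρ : ∀ l, w l * ∑' i, g (l, i) ≤ ρ l)
    (hs : Summable ρ) :
    Summable (fun q : ℕ × ℕ => w q.1 * g q) ∧ ∑' q : ℕ × ℕ, w q.1 * g q ≤ ∑' l, ρ l := by
  have hrow : ∀ l, Summable fun i => w l * g (l, i) := fun l => (hg l).mul_left _
  have h1 : Summable fun l => ∑' i, w l * g (l, i) := by
    refine Summable.of_nonneg_of_le (fun l => tsum_nonneg fun i => mul_nonneg (hw l) (hg0 _))
      (fun l => ?_) hs
    rw [tsum_mul_left]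
    exact hρ l
  have h2 : Summable (fun q : ℕ × ℕ => w q.1 * g q) :=
    (summable_prod_of_nonneg fun q => mul_nonneg (hw q.1) (hg0 q)).2 ⟨hrow, h1⟩
  refine ⟨h2, ?_⟩
  rw [h2.tsum_prod' hrow]
  exact h1.tsum_le_tsum (fun l => tsum_mul_left.trans_le (hρ l)) hs

section

variable {E : Type*} [AddCommGroup E] [Module ℂ E] [UniformSpace E] [IsUniformAddGroup E]
  [ContinuousSMul ℂ E] [CompleteSpace E] [T2Space E] {p : ℕ → Seminorm ℂ E} {A : E →ₗ.[ℂ] E}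

theorem isCompleteOrbit_tsum (hp : WithSeminorms p) (hmono : Monotone p) (hA : A.IsClosed)
    {β : Type*} [Countable β] {g : β → ℝ → E} (hg : ∀ b, IsCompleteOrbit A (g b))
    (hb : ∀ R k, ∃ M : β → ℝ, Summable M ∧ ∀ b, ∀ t ∈ Icc (-R) R, p k (g b t) ≤ M b) :
    (∀ t, Summable fun b => g b t) ∧ IsCompleteOrbit A fun t => ∑' b, g b t := by
  choose M hM hgM using hb
  have hsum : ∀ t, Summable fun b => g b t := fun t =>
    hp.summable_of_dominated (hM |t|) (fun k b => hgM |t| k b) ⟨neg_abs_le t, le_abs_self t⟩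
  refine ⟨hsum, ⟨?_, fun a c => ?_⟩⟩
  · refine continuous_iff_continuousAt.2 fun t => ?_
    refine (hp.continuousOn_tsum_of_dominated (fun b => (hg b).continuous.continuousOn)
      (hM (|t| + 1)) (fun k b => hgM (|t| + 1) k b)).continuousAt (Icc_mem_nhds ?_ ?_)
    · linarith [neg_abs_le t]
    · linarith [le_abs_self t]
  · choose y hy hyA using fun b => (hg b).integral a c
    have hsub : uIcc a c ⊆ Icc (-(|a| + |c|)) (|a| + |c|) := by
      refine uIcc_subset_Icc ⟨?_, ?_⟩ ⟨?_, ?_⟩ <;>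
        linarith [neg_abs_le a, neg_abs_le c, le_abs_self a, le_abs_self c, abs_nonneg a,
          abs_nonneg c]
    obtain ⟨h1, h2⟩ := hp.hasVectorIntegral_tsum hmono
      (fun b => (hg b).continuous.continuousOn) (hM (|a| + |c|))
      (fun k b t ht => hgM (|a| + |c|) k b t (hsub ht)) hy
    refine ⟨_, h2, ?_⟩
    exact IsClosed.mem_of_tendsto hA
      (h1.hasSum.prodMk ((hsum c).hasSum.sub (hsum a).hasSum))
      (Eventually.of_forall fun s => A.graph.sum_mem fun b _ => hyA b)

/-- The gaps `K l` are chosen so large, relative to the decay constants of the first `l` orbits in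
the first `l` seminorms, that near `T * m (l, i)` all other translates together are at most `2 * (1
/ 2) ^ l` in `p l`. -/
theorem exists_orbit_visiting_linearly_often [SecondCountableTopology E] (hp : WithSeminorms p)
    (hmono : Monotone p) (hA : A.IsClosed) {F : Submodule ℂ E} (hF : IsClosed (F : Set E)) {T : ℝ}
    (hT : 0 < T) :
    ∃ u : ℝ → E, IsCompleteOrbit A u ∧ (∀ t, u t ∈ F) ∧
      ∀ V : Set E, IsOpen V → (V ∩ rapidOrbitSubmodule p A F).Nonempty →
        ∃ (g : ℕ → ℕ) (L : ℕ) (δ : ℝ), Function.Injective g ∧ (∀ i, 1 ≤ g i) ∧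
          (∀ i, g i ≤ L * (i + 1)) ∧ 0 < δ ∧ ∀ i t, |t - T * g i| ≤ δ → u t ∈ V := by
  set W := rapidOrbitSubmodule p A F with hW
  -- `W` need not be closed; second countability passes to it and provides a dense sequence inside
  -- `W` itself.
  have : SecondCountableTopology W :=
    TopologicalSpace.Subtype.secondCountableTopology (W : Set E)
  set x := TopologicalSpace.denseSeq W with hx
  have hxW : ∀ d, ∃ u, IsRapidOrbit p A F u ∧ u 0 = x d := fun d => (x d).2
  choose Y' hY' hY'0 using hxW
  -- Unpairing repeats each orbit at arbitrarily large `l`, where the error is small and the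
  -- controlled seminorm is strong.
  set Y : ℕ → ℝ → E := fun l => Y' (Nat.unpair l).1 with hYdef
  have hY : ∀ l, IsRapidOrbit p A F (Y l) := fun l => hY' _
  choose M hM using fun k l => (hY l).decay k
  have hM0 : ∀ k l, 0 ≤ M k l := fun k l => by
    simpa using (apply_nonneg _ _).trans (hM k l 0)
  set σ : ℕ → ℝ := fun L => ∑ k ∈ Finset.range (L + 1), ∑ l ∈ Finset.range (L + 1), M k l with hσ
  have hσ0 : ∀ L, 0 ≤ σ L := fun L => Finset.sum_nonneg fun k _ => Finset.sum_nonneg fun l _ => hM0 k l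
  have hMσ : ∀ {k l L}, k ≤ L → l ≤ L → M k l ≤ σ L := fun {k l L} hk hl =>
    (Finset.single_le_sum (f := fun l => M k l) (fun l _ => hM0 k l)
      (Finset.mem_range.2 (Nat.lt_succ_of_le hl))).trans
    (Finset.single_le_sum (f := fun k => ∑ l ∈ Finset.range (L + 1), M k l)
      (fun k _ => Finset.sum_nonneg fun l _ => hM0 k l) (Finset.mem_range.2 (Nat.lt_succ_of_le hk)))
  -- If `|t - T * n| ≤ T / 2` and `d = n - m q ≠ 0`, then `|t - T * m q| ≥ T * |d| / 2`, so the
  -- decay factor is at most `c / d ^ 2`.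
  set c : ℝ := 4 / T ^ 2 with hc
  have hc0 : 0 < c := by positivity
  set ε : ℕ → ℝ := fun L => (1 / 4) ^ L / (c * (1 + σ L)) with hε
  have hε0 : ∀ L, 0 < ε L := fun L => by have := hσ0 L; positivity
  have hMε : ∀ {k l L}, k ≤ L → l ≤ L → M k l * c * ε L ≤ (1 / 4) ^ L := fun {k l L} hk hl => by
    have h1 := hMσ hk hl
    have h2 := hσ0 L
    calc M k l * c * ε L ≤ (1 + σ L) * c * ε L := by
          have := (hε0 L).le
          gcongr
          linarith
      _ = (1 / 4) ^ L := by simp only [hε]; field_simp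
  choose K hK using fun L => exists_inv_sq_tail_bound (hε0 L)
  obtain ⟨m, hm1, hm2, hm3⟩ := exists_separated_positions K
  have hminj : Function.Injective m := fun q q' h => by
    by_contra hne
    have := hm2 q q' hne
    rw [h] at this
    simp at this
    omega
  set g : ℕ × ℕ → ℝ → E := fun q t => Y q.1 (t + -(T * m q)) with hg
  have hgdec : ∀ k q t, p k (g q t) ≤ M k q.1 / (1 + (t - T * m q) ^ 2) := fun k q t => hM k q.1 _
  -- domination of the orbit on compact intervals
  have hdom : ∀ R k, ∃ B : ℕ × ℕ → ℝ, Summable B ∧ ∀ q, ∀ t ∈ Icc (-R) R, p k (g q t) ≤ B q := by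
    intro R k
    -- This comes from `(T m)² ≤ 2 t² + 2 (t - T m)² ≤ 2 (1 + R²) (1 + (t - T m)²)` for `|t| ≤ R`.
    set D : ℝ := 2 * (1 + R ^ 2) / T ^ 2 with hD
    have hD0 : 0 ≤ D := by positivity
    have hrow : ∀ l, Summable (fun i => 1 / ((m (l, i) : ℤ) : ℝ) ^ 2) ∧
        ∑' i, 1 / ((m (l, i) : ℤ) : ℝ) ^ 2 ≤ ε l := fun l => by
      refine summable_inv_sq_and_tsum_le (hK l) (g := fun i => (m (l, i) : ℤ)) (fun i i' h => ?_)
        fun i => Or.inr ?_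
      · have := hminj (Nat.cast_injective h)
        simpa using this
      · have := hm1 (l, i)
        simp only at this
        rw [abs_of_nonneg (by omega)]
        omega
    have hs : Summable fun l => M k l * D * ε l := by
      -- The bound `hMε` controls `p k` only on rows `l ≥ k`; finitely many rows are dropped.
      refine (summable_nat_add_iff k).1 ?_
      refine Summable.of_nonneg_of_le (fun l => by have := hM0 k (l + k); have := (hε0 (l + k)).le; positivity)
        (fun l => ?_) (((summable_nat_add_iff k).2 (summable_geometric_of_lt_one
          (by norm_num : (0 : ℝ) ≤ 1 / 4) (by norm_num))).mul_left (D / c))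
      calc M k (l + k) * D * ε (l + k) = D / c * (M k (l + k) * c * ε (l + k)) := by field_simp
        _ ≤ D / c * (1 / 4) ^ (l + k) := by
          gcongr
          exact hMε (Nat.le_add_left _ _) le_rfl
    refine ⟨fun q => M k q.1 * D * (1 / ((m q : ℤ) : ℝ) ^ 2),
      (summable_weighted_rows (w := fun l => M k l * D) (fun l => mul_nonneg (hM0 k l) hD0)
        (g := fun q => 1 / ((m q : ℤ) : ℝ) ^ 2) (fun q => by positivity) (fun l => (hrow l).1)
        (fun l => mul_le_mul_of_nonneg_left (hrow l).2 (mul_nonneg (hM0 k l) hD0)) hs).1,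
      fun q t ht => (hgdec k q t).trans ?_⟩
    have hmq : (0 : ℝ) < m q := by
      have := hm1 q
      exact_mod_cast (by omega : 0 < m q)
    have ht2 : t ^ 2 ≤ R ^ 2 := sq_le_sq' ht.1 ht.2
    beta_reduce
    rw [div_eq_mul_one_div, mul_assoc]
    refine mul_le_mul_of_nonneg_left ?_ (hM0 k q.1)
    rw [hD, Int.cast_natCast, div_mul_div_comm, mul_one, div_le_div_iff₀ (by positivity) (by positivity)]
    nlinarith [sq_nonneg (T * m q - 2 * t), sq_nonneg (R * (t - T * m q)), sq_nonneg (t - T * m q)]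
  obtain ⟨hsum, horb⟩ := isCompleteOrbit_tsum hp hmono hA (g := g)
    (fun q => (hY q.1).toIsCompleteOrbit.comp_add_right (-(T * m q))) hdom
  refine ⟨_, horb, fun t => hF.mem_of_tendsto (hsum t).hasSum (Eventually.of_forall fun s =>
    F.sum_mem fun q _ => (hY q.1).mem _), ?_⟩
  -- the orbit is close to `Y l` near `T * m (l, i)`
  have herr : ∀ l i t, |t - T * m (l, i)| ≤ T / 2 →
      p l ((∑' q, g q t) - Y l (t - T * m (l, i))) ≤ 2 * (1 / 2) ^ l := by
    intro l i t ht
    set n : ℕ := m (l, i) with hn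
    have hrow : ∀ l', Summable (fun i' => 1 / (((n : ℤ) - m (l', i') : ℤ) : ℝ) ^ 2) ∧
        ∑' i', 1 / (((n : ℤ) - m (l', i') : ℤ) : ℝ) ^ 2 ≤ ε (max l l') := fun l' => by
      refine summable_inv_sq_and_tsum_le (hK (max l l')) (g := fun i' => (n : ℤ) - m (l', i'))
        (fun i₁ i₂ h => ?_) fun i' => ?_
      · have := @hminj (l', i₁) (l', i₂) (by simp only at h; omega)
        simpa using this
      · by_cases hq : (l, i) = (l', i')
        · left
          rw [hn, hq, sub_self]
        · right
          have e1 := hm2 _ _ hq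
          have e2 := hm2 _ _ (Ne.symm hq)
          rw [abs_sub_comm] at e2
          rcases max_cases l l' with ⟨h, -⟩ | ⟨h, -⟩ <;> rw [h]
          · exact e1
          · exact e2
    have hρ : ∀ l', M l l' * c * ∑' i', 1 / (((n : ℤ) - m (l', i') : ℤ) : ℝ) ^ 2 ≤
        (1 / 2) ^ l * (1 / 2) ^ l' := fun l' => by
      have h0 : 0 ≤ M l l' * c := mul_nonneg (hM0 _ _) hc0.le
      refine (mul_le_mul_of_nonneg_left (hrow l').2 h0).trans
        ((hMε (le_max_left l l') (le_max_right l l')).trans ?_)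
      -- Since `l + l' ≤ 2 * max l l'`, the bound `(1/4)^max` splits into a factor in `l` and one
      -- summable in `l'`.
      have e : (1 / 4 : ℝ) = (1 / 2) ^ 2 := by norm_num
      rw [e, ← pow_mul, ← pow_add]
      refine pow_le_pow_of_le_one (by norm_num) (by norm_num) ?_
      omega
    obtain ⟨hs1, hs2⟩ := summable_weighted_rows (w := fun l' => M l l' * c)
      (fun l' => mul_nonneg (hM0 _ _) hc0.le)
      (g := fun q => 1 / (((n : ℤ) - m q : ℤ) : ℝ) ^ 2) (fun q => by positivity)
      (fun l' => (hrow l').1) hρ (summable_geometric_two.mul_left _)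
    rw [tsum_mul_left, tsum_geometric_two, mul_comm] at hs2
    rw [(hsum t).tsum_eq_add_tsum_ite (l, i)]
    have hY1 : g (l, i) t = Y l (t - T * n) := rfl
    rw [hY1, add_sub_cancel_left]
    have hle : ∀ q, p l (if q = (l, i) then 0 else g q t) ≤
        M l q.1 * c * (1 / (((n : ℤ) - m q : ℤ) : ℝ) ^ 2) := by
      intro q
      split_ifs with hq
      · rw [map_zero]
        exact mul_nonneg (mul_nonneg (hM0 _ _) hc0.le) (by positivity)
      · refine (hgdec l q t).trans ?_
        rw [div_eq_mul_one_div, mul_assoc]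
        refine mul_le_mul_of_nonneg_left ?_ (hM0 _ _)
        have hne : (n : ℤ) - m q ≠ 0 := fun h => hq (hminj (by omega))
        have h1 : (1 : ℝ) ≤ |(((n : ℤ) - m q : ℤ) : ℝ)| := by
          exact_mod_cast Int.one_le_abs hne
        set d : ℝ := (((n : ℤ) - m q : ℤ) : ℝ) with hd
        have hd' : t - T * m q = (t - T * n) + T * d := by
          rw [hd]
          push_cast
          ring
        have h2 : T * |d| / 2 ≤ |t - T * m q| := by
          have h3 : |T * d| ≤ |t - T * m q| + |t - T * n| := by
            have : T * d = (t - T * m q) - (t - T * n) := by rw [hd']; ring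
            rw [this]
            exact abs_sub _ _
          rw [abs_mul, abs_of_pos hT] at h3
          nlinarith
        have h3 : (T * |d| / 2) ^ 2 ≤ (t - T * m q) ^ 2 := by
          rw [← sq_abs (t - T * m q)]
          gcongr
        have hd0 : 0 < d ^ 2 := by
          rw [← sq_abs]
          positivity
        rw [hc, div_mul_div_comm, mul_one, div_le_div_iff₀ (by positivity) (by positivity)]
        rw [div_pow, mul_pow, sq_abs] at h3
        nlinarith
    have hs3 : Summable fun q => p l (if q = (l, i) then 0 else g q t) :=
      Summable.of_nonneg_of_le (fun _ => apply_nonneg _ _) hle hs1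
    have hs4 : Summable fun q => if q = (l, i) then 0 else g q t := by
      refine (hsum t).congr_cofinite ?_
      filter_upwards [(Set.finite_singleton (l, i)).compl_mem_cofinite] with q hq
      rw [if_neg (show q ≠ (l, i) from hq)]
    exact (hp.seminorm_tsum_le hs4 hs3).trans ((hs3.tsum_le_tsum hle hs1).trans hs2)
  rintro V hV ⟨v, hvV, hvW⟩
  obtain ⟨k, r, hr, hball⟩ := hp.exists_ball_subset_of_monotone hmono hV hvV
  obtain ⟨d, hd⟩ : ∃ d, p k (x d - v) < r / 3 := by
    have hopen : IsOpen {y : W | p k (y - v) < r / 3} :=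
      isOpen_lt ((hp.continuous_seminorm k).comp (by fun_prop)) continuous_const
    exact (TopologicalSpace.denseRange_denseSeq W).exists_mem_open hopen
      ⟨⟨v, hvW⟩, by simpa using by positivity⟩
  -- The threshold `r / 6` makes the error `2 * (1 / 2) ^ l` smaller than `r / 3`, one of three such
  -- errors.
  obtain ⟨j, hj⟩ := exists_pow_lt_of_lt_one (show 0 < r / 6 by positivity)
    (show (1 / 2 : ℝ) < 1 by norm_num)
  set l := Nat.pair d (max j k) with hl
  have hlj : j ≤ l := (le_max_left j k).trans (Nat.right_le_pair d _)
  have hlk : k ≤ l := (le_max_right j k).trans (Nat.right_le_pair d _)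
  have hYl : Y l = Y' d := by simp [hYdef, hl]
  obtain ⟨δ₀, hδ₀, hcont⟩ : ∃ δ₀ > 0, ∀ τ, |τ| < δ₀ → p k (Y l τ - x d) < r / 3 := by
    have h1 : Tendsto (fun τ => p k (Y l τ - x d)) (𝓝 0) (𝓝 0) := by
      have h2 : Continuous fun τ => p k (Y l τ - x d) :=
        (hp.continuous_seminorm k).comp ((hY l).continuous.sub continuous_const)
      have h3 := h2.tendsto 0
      rwa [hYl, hY'0, sub_self, map_zero, ← hYl] at h3
    obtain ⟨δ₀, hδ₀, h⟩ := Metric.eventually_nhds_iff.1 (h1.eventually_lt_const (by positivity : 0 < r / 3))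
    exact ⟨δ₀, hδ₀, fun τ hτ => h (by simpa using hτ)⟩
  obtain ⟨L, hL⟩ := hm3 l
  refine ⟨fun i => m (l, i), L, min (δ₀ / 2) (T / 2), fun i i' h => ?_, fun i => ?_, hL,
    by positivity, fun i t ht => hball _ ?_⟩
  · simpa using hminj h
  · exact Nat.one_le_of_lt (hm1 (l, i))
  · have h1 := herr l i t (ht.trans (min_le_right _ _))
    have h2 := hcont (t - T * m (l, i)) (ht.trans_lt ((min_le_left _ _).trans_lt (by linarith)))
    have h3 : (1 / 2 : ℝ) ^ l ≤ (1 / 2) ^ j := pow_le_pow_of_le_one (by norm_num) (by norm_num) hlj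
    have e : (∑' q, g q t) - v = ((∑' q, g q t) - Y l (t - T * m (l, i))) +
        (Y l (t - T * m (l, i)) - x d) + (x d - v) := by abel
    have h4 := map_add_le_add (p k) ((∑' q, g q t) - Y l (t - T * m (l, i)))
      (Y l (t - T * m (l, i)) - x d)
    have h5 := map_add_le_add (p k) (((∑' q, g q t) - Y l (t - T * m (l, i))) +
        (Y l (t - T * m (l, i)) - x d)) (x d - v)
    have h6 := hmono hlk ((∑' q, g q t) - Y l (t - T * m (l, i)))
    change p k ((∑' q, g q t) - v) < r
    rw [e]
    linarith

end

/-! ### The part of a subgenerator in an invariant subspace -/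

section Part

variable {E : Type*} [AddCommGroup E] [Module ℂ E] {A : E →ₗ.[ℂ] E} {F : Submodule ℂ E}

theorem IsMildSolution.of_part [TopologicalSpace E] {x : F} {v : ℝ → F}
    (hv : IsMildSolution (A.part F) x v) : IsMildSolution A (x : E) fun t => (v t : E) := by
  refine ⟨continuous_subtype_val.comp_continuousOn hv.1, fun t ht => ?_⟩
  obtain ⟨y, hy, hg⟩ := hv.2 t ht
  exact ⟨y, hy.map F.subtypeL, (A.mem_graph_part F _ _).1 hg⟩

theorem IsCompleteOrbit.part [TopologicalSpace E] [IsTopologicalAddGroup E] [ContinuousSMul ℂ E]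
    [LocallyConvexSpace ℝ E] [PolynormableSpace ℂ E] (hF : IsClosed (F : Set E)) {u : ℝ → E}
    (hu : IsCompleteOrbit A u) (huF : ∀ t, u t ∈ F) :
    IsCompleteOrbit (A.part F) fun t => (⟨u t, huF t⟩ : F) where
  continuous := hu.continuous.subtype_mk huF
  integral a b := by
    obtain ⟨y, hy, hg⟩ := hu.integral a b
    have hyF : y ∈ F := hy.mem_of_isClosed hF fun s _ => huF s
    exact ⟨⟨y, hyF⟩, HasVectorIntegral.of_subtype hy, (A.mem_graph_part F _ _).2 hg⟩

variable [UniformSpace E] [IsUniformAddGroup E] [ContinuousSMul ℂ E] [PolynormableSpace ℂ E]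
  [LocallyConvexSpace ℝ E] {C : E →L[ℂ] E} {S : ℝ → E →L[ℂ] E}
  {C' : F →L[ℂ] F} {S' : ℝ → F →L[ℂ] F}

theorem IsSubgenerator.part (hS : IsSubgenerator A C S) (hF : IsClosed (F : Set E))
    (hC' : ∀ x : F, (C' x : E) = C x) (hS' : ∀ t : ℝ, 0 ≤ t → ∀ x : F, (S' t x : E) = S t x) :
    IsSubgenerator (A.part F) C' S' where
  isClosed := by
    have h1 : Continuous fun q : F × F => ((q.1 : E), (q.2 : E)) := by fun_prop
    have h2 : ((A.part F).graph : Set (F × F)) =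
        (fun q : F × F => ((q.1 : E), (q.2 : E))) ⁻¹' (A.graph : Set (E × E)) := by
      ext ⟨x, y⟩
      exact A.mem_graph_part F x y
    change IsClosed _
    rw [h2]
    exact IsClosed.preimage h1 hS.isClosed
  injective x y h := by
    refine Subtype.ext (hS.injective ?_)
    rw [← hC', ← hC', h]
  continuousOn x := by
    rw [IsInducing.subtypeVal.continuousOn_iff]
    exact (hS.continuousOn x).congr fun t ht => hS' t ht x
  commute_op t ht x y h := by
    rw [LinearPMap.mem_graph_part] at h ⊢
    rw [hS' t ht, hS' t ht]
    exact hS.commute_op t ht _ _ h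
  commute_reg t ht x := by
    refine Subtype.ext ?_
    rw [hS' t ht, hC', hC', hS' t ht, hS.commute_reg t ht]
  integral t ht x := by
    obtain ⟨y, hy, hg⟩ := hS.integral t ht x
    have h1 : HasVectorIntegral (fun s => (S' s x : E)) 0 t y := hy.congr fun s hs => by
      rw [uIcc_of_le ht] at hs
      exact (hS' s hs.1 x).symm
    have hyF : y ∈ F := h1.mem_of_isClosed hF fun s _ => (S' s x).2
    refine ⟨⟨y, hyF⟩, HasVectorIntegral.of_subtype h1, ?_⟩
    rw [LinearPMap.mem_graph_part, Submodule.coe_sub, hS' t ht, hC']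
    exact hg

/-- Mild solutions for the part are mild solutions for `A`, so uniqueness descends from `E` and `F`
need not be barrelled. -/
theorem IsSubgenerator.mem_solutionOp_part [BarrelledSpace ℂ E] [T2Space E]
    (hS : IsSubgenerator A C S) (hC' : ∀ x : F, (C' x : E) = C x)
    (hS' : ∀ t : ℝ, 0 ≤ t → ∀ x : F, (S' t x : E) = S t x) {x : F} {u : ℝ → F}
    (hu : IsMildSolution (A.part F) x u) {t : ℝ} (ht : 0 ≤ t) :
    (x, u t) ∈ solutionOp (A.part F) C' S' t := by
  refine ⟨⟨u, hu, fun v hv s hs => Subtype.ext (hS.injective ?_)⟩, Subtype.ext ?_⟩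
  · rw [hS.apply_mildSolution hv.of_part hs, hS.apply_mildSolution hu.of_part hs]
  · change (C' (u t) : E) = S' t x
    rw [hC', hS' t ht, hS.apply_mildSolution hu.of_part ht]

end Part

/-- On an eigenvector `S t` acts as a scalar multiple of `C`; linearity and continuity extend the
invariance to the closed span. -/
theorem IsSubgenerator.mapsTo_closure_span {E : Type*} [AddCommGroup E] [Module ℂ E]
    [UniformSpace E] [IsUniformAddGroup E] [ContinuousSMul ℂ E] [BarrelledSpace ℂ E]
    [PolynormableSpace ℂ E] [LocallyConvexSpace ℝ E] [T2Space E] {A : E →ₗ.[ℂ] E} {C : E →L[ℂ] E}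
    {S : ℝ → E →L[ℂ] E} (hS : IsSubgenerator A C S) {Ω : Set ℂ} {f : ℂ → E}
    (hf : ∀ z ∈ Ω, (f z, z • f z) ∈ A.graph) {F : Submodule ℂ E}
    (hF : F = (Submodule.span ℂ (f '' Ω)).topologicalClosure) (hC : ∀ x ∈ F, C x ∈ F) {t : ℝ}
    (ht : 0 ≤ t) {x : E} (hx : x ∈ F) : S t x ∈ F := by
  have hFc : IsClosed (F : Set E) := hF ▸ Submodule.isClosed_topologicalClosure _
  have hspan : Submodule.span ℂ (f '' Ω) ≤ F := hF ▸ Submodule.le_topologicalClosure _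
  have h1 : F ≤ F.comap (S t).toLinearMap := by
    conv_lhs => rw [hF]
    refine Submodule.topologicalClosure_minimal _ (Submodule.span_le.2 ?_)
      (hFc.preimage (S t).continuous)
    rintro _ ⟨z, hz, rfl⟩
    change S t (f z) ∈ F
    rw [hS.apply_eigenvector (hf z hz) ht]
    exact F.smul_mem _ (hC _ (hspan (Submodule.subset_span ⟨z, hz, rfl⟩)))
  exact h1 hx

/-! ### Frequent hypercyclicity from linearly frequent visits -/

/-- For each open set `V` meeting `F` there is a sequence of positive integers `g i`, of at most
linear growth, such that `u t ∈ V` for `t` in a fixed neighbourhood of `T * g i`. -/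
def VisitsLinearlyOften {E : Type*} [TopologicalSpace E] (u : ℝ → E) (F : Set E) (T : ℝ) : Prop :=
  ∀ V : Set E, IsOpen V → (V ∩ F).Nonempty →
    ∃ (g : ℕ → ℕ) (L : ℕ) (δ : ℝ), Function.Injective g ∧ (∀ i, 1 ≤ g i) ∧
      (∀ i, g i ≤ L * (i + 1)) ∧ 0 < δ ∧ ∀ i t, |t - T * g i| ≤ δ → u t ∈ V

namespace VisitsLinearlyOften

variable {E : Type*} [TopologicalSpace E] {u : ℝ → E} {F V : Set E} {T : ℝ}

theorem natLowerDensity_pos (h : VisitsLinearlyOften u F T) (hV : IsOpen V)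
    (hVF : (V ∩ F).Nonempty) : 0 < natLowerDensity {n | u (n * T) ∈ V} := by
  obtain ⟨g, L, δ, hg, h1, hL, hδ, hu⟩ := h V hV hVF
  exact natLowerDensity_pos_of_linear_growth hg h1 hL fun i => hu i _ (by simp [mul_comm, hδ.le])

theorem realLowerDensity_pos (h : VisitsLinearlyOften u F 1) (hV : IsOpen V)
    (hVF : (V ∩ F).Nonempty) : 0 < realLowerDensity {t | 0 ≤ t ∧ u t ∈ V} := by
  obtain ⟨g, L, δ, hg, h1, hL, hδ, hu⟩ := h V hV hVF
  have hL0 : 1 ≤ L := by have := h1 0; have := hL 0; omega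
  refine realLowerDensity_pos_of_linear_growth hg hL0 hL (lt_min hδ one_pos) (min_le_right _ _)
    fun i t ht => ⟨(Nat.cast_nonneg _).trans ht.1, hu i t ?_⟩
  rw [one_mul, abs_of_nonneg (by linarith [ht.1])]
  linarith [ht.2, min_le_left δ 1]

theorem subtype (h : VisitsLinearlyOften u F T) (huF : ∀ t, u t ∈ F) :
    VisitsLinearlyOften (fun t => (⟨u t, huF t⟩ : F)) univ T := by
  rintro V hV ⟨⟨x, hx⟩, hxV, -⟩
  obtain ⟨V', hV', rfl⟩ := isOpen_induced_iff.1 hV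
  exact h V' hV' ⟨x, hxV, hx⟩

theorem isFrequentlyHypercyclicOp (h : VisitsLinearlyOften u univ T) {R : Set (E × E)}
    (hR : ∀ s, 0 ≤ s → (u s, u (s + T)) ∈ R) (hT : 0 ≤ T) : IsFrequentlyHypercyclicOp R := by
  refine ⟨fun n => u (n * T), fun n => ?_, fun V hV hne => h.natLowerDensity_pos hV (by simpa)⟩
  have := hR (n * T) (by positivity)
  simpa [add_mul] using this

theorem isFrequentlyHypercyclicFamily (h : VisitsLinearlyOften u univ 1) {R : ℝ → Set (E × E)}
    (hR : ∀ t, 0 ≤ t → (u 0, u t) ∈ R t) : IsFrequentlyHypercyclicFamily R :=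
  ⟨u 0, u, hR, fun V hV hne => h.realLowerDensity_pos hV (by simpa)⟩

end VisitsLinearlyOften

theorem IsCompleteOrbit.isMildSolution_add {E : Type*} [AddCommGroup E] [Module ℂ E]
    [TopologicalSpace E] {A : E →ₗ.[ℂ] E} {u : ℝ → E} (hu : IsCompleteOrbit A u) (s : ℝ) :
    IsMildSolution A (u s) fun t => u (s + t) := by
  simpa [add_comm] using (hu.comp_add_right s).isMildSolution

/-! ### The main theorem -/

theorem theorem2p12 {E : Type*} [AddCommGroup E] [Module ℂ E] [UniformSpace E]
    [IsUniformAddGroup E] [ContinuousSMul ℂ E] [T2Space E] [CompleteSpace E]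
    [TopologicalSpace.SeparableSpace E]
    (p : ℕ → Seminorm ℂ E) (hp_mono : Monotone p) (hp : WithSeminorms p)
    (hdim : ¬ FiniteDimensional ℂ E)
    (A : E →ₗ.[ℂ] E) (C : E →L[ℂ] E) (S : ℝ → E →L[ℂ] E)
    (hS : IsSubgenerator A C S) (hC : DenseRange C)
    (Ω : Set ℂ) (hΩ_open : IsOpen Ω) (hΩ_conn : IsConnected Ω)
    (hΩ_spec : Ω ⊆ A.pointSpectrum) (hΩ_im : ∃ z ∈ Ω, z.re = 0)
    (f : ℂ → E) (hf : IsAnalyticMapOn f Ω)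
    (hf_eig : ∀ z ∈ Ω, (f z, z • f z) ∈ A.graph ∧ f z ≠ 0)
    (F : Submodule ℂ E) (hF : F = (Submodule.span ℂ (f '' Ω)).topologicalClosure) :
    ((∀ φ : E →L[ℂ] ℂ, (∀ z ∈ Ω, φ (f z) = 0) → φ = 0) →
      IsFrequentlyHypercyclicSemigroup A C S ∧
        ∀ t₀ : ℝ, 0 < t₀ → IsFrequentlyHypercyclicOp (solutionOp A C S t₀)) ∧
    (IsFrequentlyHypercyclicFamily (fun t => graphPart (solutionOp A C S t) F) ∧
      (∀ t₀ : ℝ, 0 < t₀ → IsFrequentlyHypercyclicOp (graphPart (solutionOp A C S t₀) F)) ∧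
      ((∀ x ∈ F, C x ∈ F) →
        ∃ (C' : F →L[ℂ] F) (S' : ℝ → F →L[ℂ] F),
          (∀ x : F, (C' x : E) = C x) ∧
          (∀ t : ℝ, 0 ≤ t → ∀ x : F, (S' t x : E) = S t x) ∧
          IsSubgenerator (A.part F) C' S' ∧
          IsFrequentlyHypercyclicSemigroup (A.part F) C' S' ∧
          ∀ t₀ : ℝ, 0 < t₀ → IsFrequentlyHypercyclicOp (solutionOp (A.part F) C' S' t₀))) := by
  have := hp.firstCountableTopology
  have := IsUniformAddGroup.uniformity_countably_generated (α := E)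
  have := UniformSpace.secondCountable_of_separable E
  have := hp.toPolynormableSpace
  have := hp.toLocallyConvexSpace
  have hFc : IsClosed (F : Set E) := hF ▸ Submodule.isClosed_topologicalClosure _
  have hspan : Submodule.span ℂ (f '' Ω) ≤ F := hF ▸ Submodule.le_topologicalClosure _
  have hgraph : ∀ z ∈ Ω, (f z, z • f z) ∈ A.graph := fun z hz => (hf_eig z hz).1
  obtain ⟨z₀, hz₀, hre⟩ := hΩ_im
  have hdense : F ≤ (rapidOrbitSubmodule p A F).topologicalClosure := by
    rw [hF]
    exact closure_span_le_closure_rapidOrbitSubmodule hp hp_mono hS.isClosed hΩ_open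
      hΩ_conn.isPreconnected hz₀ hre hf hgraph
  have hvisit : ∀ T : ℝ, 0 < T → ∃ u : ℝ → E, IsCompleteOrbit A u ∧ (∀ t, u t ∈ F) ∧
      VisitsLinearlyOften u F T := fun T hT => by
    obtain ⟨u, hu, huF, h⟩ := exists_orbit_visiting_linearly_often hp hp_mono hS.isClosed hFc hT
    refine ⟨u, hu, huF, fun V hV hVF => h V hV ?_⟩
    obtain ⟨x, hxV, hxF⟩ := hVF
    exact mem_closure_iff.1 (hdense hxF) V hV hxV
  have hop : ∀ {u : ℝ → E}, IsCompleteOrbit A u → ∀ s t : ℝ, 0 ≤ t →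
      (u s, u (s + t)) ∈ solutionOp A C S t := fun hu s t ht =>
    hS.mem_solutionOp (hu.isMildSolution_add s) ht
  have hop0 : ∀ {u : ℝ → E}, IsCompleteOrbit A u → ∀ t : ℝ, 0 ≤ t →
      (u 0, u t) ∈ solutionOp A C S t := fun hu t ht => by simpa using hop hu 0 t ht
  refine ⟨fun hφ => ?_, ?_, fun t₀ ht₀ => ?_, fun hCF => ?_⟩
  -- By Hahn–Banach the extra assumption of (i) says exactly that `F` is the whole space.
  · have htop : (F : Set E) = univ := by
      refine eq_univ_of_forall fun x => Submodule.mem_of_forall_dual_eq_zero hFc fun φ h => ?_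
      rw [hφ φ fun z hz => h _ (hspan (Submodule.subset_span ⟨z, hz, rfl⟩))]
      rfl
    refine ⟨?_, fun t₀ ht₀ => ?_⟩
    · obtain ⟨u, hu, -, hv⟩ := hvisit 1 one_pos
      rw [htop] at hv
      exact hv.isFrequentlyHypercyclicFamily (hop0 hu)
    · obtain ⟨u, hu, -, hv⟩ := hvisit t₀ ht₀
      rw [htop] at hv
      exact hv.isFrequentlyHypercyclicOp (fun s _ => hop hu s t₀ ht₀.le) ht₀.le
  · obtain ⟨u, hu, huF, hv⟩ := hvisit 1 one_pos
    exact (hv.subtype huF).isFrequentlyHypercyclicFamily fun t ht => hop0 hu t ht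
  · obtain ⟨u, hu, huF, hv⟩ := hvisit t₀ ht₀
    exact (hv.subtype huF).isFrequentlyHypercyclicOp (fun s _ => hop hu s t₀ ht₀.le) ht₀.le
  · have hSF : ∀ t : ℝ, 0 ≤ t → ∀ x : F, S t x ∈ F := fun t ht x =>
      hS.mapsTo_closure_span hgraph hF hCF ht x.2
    let C' : F →L[ℂ] F := (C.comp F.subtypeL).codRestrict F fun x => hCF x x.2
    -- For negative `t` nothing forces `S t` to preserve `F`, hence the `max t 0`.
    let S' : ℝ → F →L[ℂ] F := fun t => ((S (max t 0)).comp F.subtypeL).codRestrict F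
      fun x => hSF _ (le_max_right t 0) x
    have hC' : ∀ x : F, (C' x : E) = C x := fun _ => rfl
    have hS' : ∀ t : ℝ, 0 ≤ t → ∀ x : F, (S' t x : E) = S t x := fun t ht x => by
      change S (max t 0) x = S t x
      rw [max_eq_left ht]
    have hop' : ∀ {u : ℝ → F}, IsCompleteOrbit (A.part F) u → ∀ s t : ℝ, 0 ≤ t →
        (u s, u (s + t)) ∈ solutionOp (A.part F) C' S' t := fun hu s t ht =>
      hS.mem_solutionOp_part hC' hS' (hu.isMildSolution_add s) ht
    refine ⟨C', S', hC', hS', hS.part hFc hC' hS', ?_, fun t₀ ht₀ => ?_⟩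
    · obtain ⟨u, hu, huF, hv⟩ := hvisit 1 one_pos
      exact (hv.subtype huF).isFrequentlyHypercyclicFamily fun t ht => by
        simpa using hop' (hu.part hFc huF) 0 t ht
    · obtain ⟨u, hu, huF, hv⟩ := hvisit t₀ ht₀
      exact (hv.subtype huF).isFrequentlyHypercyclicOp
        (fun s _ => hop' (hu.part hFc huF) s t₀ ht₀.le) ht₀.le
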